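/- Let $\omega(s)=\sum_{j,k=1}^{\infty}\bigl(jk(j+k)\bigr)^{-s}$, a series that converges absolutely for $\operatorname{Re}(s)>2/3$; it has a (unique) continuation to a meromorphic function on $\mathbb{C}$, also denoted by $\omega$. The meromorphic function $\Gamma(s)\omega(s)$ on $\mathbb C$ has (a) a simple pole at $s=\tfrac23$ with residue $\tfrac13\,\Gamma\!\left(\tfrac13\right)^2$; (b) a simple pole at $s=0$ with residue $\tfrac13$; (c) for each $k=0,1,2,\ldots$, a simple pole at $s=\tfrac12-k$ with residue $\dfrac{\sqrt{\pi}}{4^k\,k!}\,\zeta\!\left(\dfrac{1-6k}{2}\right)$, where $\zeta$ is the Riemann zeta function; and it has no other singularities (removable singularities being removed). In particular, it has no poles at the negative integers $s=-1,-2,\ldots$. This last fact is equivalent to the Bernoulli number identity $$\frac{B_{6n+2}}{6n+2}=-\frac{(4n+1)!}{(2n)!^2}\sum_{k=1}^{n}\binom{2n}{2k-1}\frac{B_{2n+2k}}{2n+2k}\cdot\frac{B_{4n-2k+2}}{4n-2k+2}\qquad\text{for all } n\ge 1,$$ which holds; here $\sum_{n\ge0} B_n x^n/n! = x/(e^x-1)$.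 -/

import Mathlib

open Filter Topology

/-- The `(j, k)` term `1 / (j k (j + k)) ^ s` of the double Dirichlet series `ω(s)`, `j, k ≥ 1`. -/
noncomputable def wittenTerm (s : ℂ) (p : ℕ+ × ℕ+) : ℂ :=
  1 / (((p.1 * p.2 * (p.1 + p.2) : ℕ+) : ℕ) : ℂ) ^ s

/-- `ω` is a meromorphic function on `ℂ` which on the half-plane `Re s > 2/3` is the
(unconditionally convergent) sum of the series `∑ 1 / (j k (j + k)) ^ s`. -/
structure IsWittenZeta (ω : ℂ → ℂ) : Prop where
  meromorphicAt : ∀ z : ℂ, MeromorphicAt ω z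
  hasSum : ∀ s : ℂ, 2 / 3 < s.re → HasSum (wittenTerm s) (ω s)

/-- `f` has a simple pole at `z` (a pole of order exactly one), with residue `r`. -/
def HasSimplePoleWithResidue (f : ℂ → ℂ) (z r : ℂ) : Prop :=
  MeromorphicAt f z ∧ meromorphicOrderAt f z = -1 ∧
    Tendsto (fun s => (s - z) * f s) (𝓝[≠] z) (𝓝 r)

/-- `f` has no singularity at `z`, after removing a removable one: near `z`, apart from the value
at `z` itself, it agrees with a function that is analytic at `z`. -/
def IsRegularAt (f : ℂ → ℂ) (z : ℂ) : Prop :=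
  ∃ g : ℂ → ℂ, AnalyticAt ℂ g z ∧ f =ᶠ[𝓝[≠] z] g

/-- The Agoh-Dilcher lacunary recurrence of index `n` for the Bernoulli numbers. -/
def BernoulliIdentity (n : ℕ) : Prop :=
  bernoulli (6 * n + 2) / (6 * n + 2 : ℚ) =
    -((Nat.factorial (4 * n + 1) : ℚ) / (Nat.factorial (2 * n) : ℚ) ^ 2) *
      ∑ k ∈ Finset.Icc 1 n, (Nat.choose (2 * n) (2 * k - 1) : ℚ) *
        (bernoulli (2 * n + 2 * k) / (2 * n + 2 * k : ℚ)) *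
        (bernoulli (4 * n - 2 * k + 2) / (4 * n - 2 * k + 2 : ℚ))

/-! For Re s > 2/3, Γ(s) ω(s) is the integral over x > 0 of x^(s-1) Li_s(e^{-x})^2. The part over
(1, ∞) is entire in s. On (0, 1], for Re s < 1, `polyLog_expansion` writes Li_s(e^{-x}) as Γ(1-s)
x^(s-1) plus a power series in x with coefficients (-1)^n ζ(s-n)/n!. Squaring and integrating
termwise yields simple fractions: one at 2/3 from the squared singular term, those at (1-n)/2 from
the cross terms, those at -n from the squared power series. The coefficients decay geometrically on
compact sets, so the result, `gammaWitten`, continues Γω to Re s < 1, and `gammaWitten_hasPolarPart`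
reads off its polar parts.

At 1/2 - k only the cross term n = 2k contributes, and the pole is genuine because ζ(1/2 - 3k) ≠ 0
(`riemannZeta_half_sub_ne_zero`). At -m with m ≥ 1 the cross term 2m+1 meets the m-th squared term,
and the residue is the rational number `residueAtNeg m`. It vanishes by parity for odd m; for m = 2n
its vanishing is exactly the Bernoulli identity, whence the equivalence.

The identity itself is proved algebraically. A functional sending X^n to ζ(-n) for n ≥ 1, applied to
the difference of a product of two Bernoulli polynomials, gives a relation of stuffle type
(`bernoulli_stuffle`). Its alternating binomial sum produces the desired relation three times over
(`sum_choose_zetaNeg_mul`). -/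

namespace WittenZeta

/-! ### The Bernoulli number identity by umbral calculus. -/

section BernoulliNumbers

open Finset
open Polynomial hiding bernoulli

/-- The linear functional on polynomials sending `X ^ n` to `c n`. -/
noncomputable def umbral (c : ℕ → ℚ) : ℚ[X] →ₗ[ℚ] ℚ :=
  Polynomial.lsum fun n => LinearMap.id.smulRight (c n)

lemma umbral_monomial (c : ℕ → ℚ) (n : ℕ) (a : ℚ) : umbral c (monomial n a) = a * c n := by
  simp [umbral, Polynomial.lsum_apply, Polynomial.sum_monomial_index]

lemma umbral_X_pow (c : ℕ → ℚ) (n : ℕ) : umbral c (X ^ n) = c n := by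
  rw [X_pow_eq_monomial, umbral_monomial, one_mul]

/-- Integration of polynomials over the unit interval. -/
noncomputable def unitIntegral : ℚ[X] →ₗ[ℚ] ℚ := umbral fun n => 1 / (n + 1)

lemma unitIntegral_derivative (p : ℚ[X]) :
    unitIntegral (derivative p) = p.eval 1 - p.eval 0 := by
  induction p using Polynomial.induction_on' with
  | add p q hp hq => simp only [map_add, hp, hq, eval_add]; ring
  | monomial n a =>
    rw [derivative_monomial, unitIntegral, umbral_monomial]
    cases n with
    | zero => simp
    | succ n =>
      have : (n : ℚ) + 1 ≠ 0 := by positivity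
      simp only [Nat.add_sub_cancel, Nat.cast_succ, eval_monomial, one_pow]
      field_simp
      simp

lemma unitIntegral_beta (a b : ℕ) :
    unitIntegral (X ^ a * (1 - X) ^ b) = a.factorial * b.factorial / (a + b + 1).factorial := by
  induction b generalizing a with
  | zero =>
    rw [pow_zero, mul_one, unitIntegral, umbral_X_pow, add_zero, Nat.factorial_succ]
    have := Nat.factorial_ne_zero a
    push_cast
    field_simp
    simp
  | succ b ih =>
    have h := unitIntegral_derivative (X ^ (a + 1) * (1 - X) ^ (b + 1))
    have hd : derivative ((X : ℚ[X]) ^ (a + 1) * (1 - X) ^ (b + 1)) =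
        ((a : ℚ) + 1) • (X ^ a * (1 - X) ^ (b + 1)) -
          ((b : ℚ) + 1) • (X ^ (a + 1) * (1 - X) ^ b) := by
      simp only [derivative_mul, derivative_pow_succ, derivative_sub,
        derivative_one, derivative_X, smul_eq_C_mul, map_add, map_natCast, map_one]
      ring
    rw [hd, map_sub, map_smul, map_smul, ih (a + 1)] at h
    simp only [eval_mul, eval_pow, eval_X, eval_sub, eval_one, sub_self, zero_pow (Nat.succ_ne_zero _),
      mul_zero, zero_mul, smul_eq_mul] at h
    have e : a + 1 + b + 1 = a + (b + 1) + 1 := by ring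
    rw [e] at h
    have h1 : ((a : ℚ) + 1) ≠ 0 := by positivity
    have h2 : unitIntegral (X ^ a * (1 - X) ^ (b + 1)) =
        ((b : ℚ) + 1) * ((a + 1).factorial * b.factorial / (a + (b + 1) + 1).factorial) /
          ((a : ℚ) + 1) := by
      rw [eq_div_iff h1]; linarith
    rw [h2, Nat.factorial_succ a, Nat.factorial_succ b]
    push_cast
    field_simp

/-- The value `-B_{l+1} / (l+1)`, equal to `ζ(-l)` for `l ≥ 1`. -/
def zetaNeg (l : ℕ) : ℚ := -bernoulli (l + 1) / (l + 1)

lemma zetaNeg_eq_zero_of_even {l : ℕ} (hl : l ≠ 0) (h : Even l) : zetaNeg l = 0 := by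
  rw [zetaNeg, bernoulli_eq_zero_of_odd h.add_one (by omega)]; simp

/-- The functional is a regularised sum of p(k) over k ≥ 0; the value `zetaNeg 0` = 1/2 = 1 + ζ(0)
counts k = 0. Naive telescoping would give -p(0), and the integral is the regularisation term. On
monomials this is the recurrence defining the Bernoulli numbers. -/
lemma umbral_zetaNeg_shift (p : ℚ[X]) :
    umbral zetaNeg (p.comp (1 + X) - p) = unitIntegral p - p.eval 0 := by
  induction p using Polynomial.induction_on' with
  | add p q hp hq =>
    have : (p + q).comp (1 + X) - (p + q) = (p.comp (1 + X) - p) + (q.comp (1 + X) - q) := by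
      rw [add_comp]; ring
    rw [this, map_add, hp, hq, map_add, eval_add]; ring
  | monomial n a =>
    rw [unitIntegral, umbral_monomial]
    have h0 : (monomial n a).comp (1 + X) - monomial n a =
        ∑ l ∈ range n, monomial l (a * (n.choose l : ℚ)) := by
      rw [← C_mul_X_pow_eq_monomial, mul_comp, C_comp, X_pow_comp, add_comm (1 : ℚ[X]), add_pow,
        sum_range_succ]
      simp only [one_pow, mul_one, Nat.choose_self, Nat.cast_one, mul_add, add_sub_cancel_right,
        mul_sum]
      refine sum_congr rfl fun l _ => ?_
      rw [← C_mul_X_pow_eq_monomial]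
      simp only [map_mul, map_natCast]
      ring
    rw [h0, map_sum]
    simp only [umbral_monomial, zetaNeg]
    have hn : (n : ℚ) + 1 ≠ 0 := by positivity
    have h1 : ∀ l ∈ range n, a * (n.choose l : ℚ) * (-bernoulli (l + 1) / (l + 1)) =
        -(a / (n + 1)) * (((n + 1).choose (l + 1) : ℚ) * bernoulli (l + 1)) := by
      intro l _
      have h2 : ((n : ℚ) + 1) * n.choose l = (n + 1).choose (l + 1) * (l + 1) := by
        exact_mod_cast Nat.add_one_mul_choose_eq n l
      have hl : (l : ℚ) + 1 ≠ 0 := by positivity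
      field_simp
      linear_combination (-a * bernoulli (l + 1)) * h2
    rw [sum_congr rfl h1, ← mul_sum]
    have h3 := _root_.sum_bernoulli (n + 1)
    rw [sum_range_succ'] at h3
    rcases eq_or_ne n 0 with rfl | h
    · simp
    · rw [if_neg (by omega)] at h3
      simp only [Nat.choose_zero_right, Nat.cast_one, _root_.bernoulli_zero, mul_one] at h3
      rw [eq_neg_of_add_eq_zero_left h3, eval_monomial, zero_pow h]
      ring

/-- Integration by parts moves one degree from one factor to the other; boundary terms cancel
because B_n(0) = B_n(1) for n ≥ 2. Only B_1, which jumps by 1, leaves a boundary term, in the base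
case. -/
lemma unitIntegral_bernoulli_mul (a b : ℕ) :
    unitIntegral (Polynomial.bernoulli (a + 1) * Polynomial.bernoulli (b + 1)) =
      (-1) ^ a * ((a + 1).factorial * (b + 1).factorial / (a + b + 2).factorial) *
        bernoulli (a + b + 2) := by
  induction a generalizing b with
  | zero =>
    have h := unitIntegral_derivative (Polynomial.bernoulli 1 * Polynomial.bernoulli (b + 2))
    have h' := unitIntegral_derivative (Polynomial.bernoulli (b + 3))
    rw [derivative_mul, derivative_bernoulli 1, derivative_bernoulli_add_one] at h
    rw [derivative_bernoulli_add_one] at h'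
    simp only [eval_mul, bernoulli_eval_one, bernoulli_eval_zero] at h h'
    rw [← bernoulli_eq_bernoulli'_of_ne_one (show b + 2 ≠ 1 by omega)] at h
    rw [← bernoulli_eq_bernoulli'_of_ne_one (show b + 3 ≠ 1 by omega)] at h'
    rw [show (((b + 2 : ℕ) : ℚ[X]) + 1) * Polynomial.bernoulli (b + 2) =
      ((b : ℚ) + 3) • Polynomial.bernoulli (b + 2) by
        rw [smul_eq_C_mul]; simp only [map_add, map_natCast, map_ofNat]; push_cast; ring, map_smul, smul_eq_mul] at h'
    have h4 : unitIntegral (Polynomial.bernoulli (b + 2)) = 0 := by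
      have : ((b : ℚ) + 3) ≠ 0 := by positivity
      have h5 := h'.trans (sub_self _)
      exact (mul_eq_zero.mp h5).resolve_left this
    rw [show ((1 : ℕ) : ℚ[X]) * Polynomial.bernoulli (1 - 1) * Polynomial.bernoulli (b + 2) +
        Polynomial.bernoulli 1 * ((((b + 1 : ℕ) : ℚ[X]) + 1) * Polynomial.bernoulli (b + 1)) =
      Polynomial.bernoulli (b + 2) +
        ((b : ℚ) + 2) • (Polynomial.bernoulli 1 * Polynomial.bernoulli (b + 1)) by
        rw [smul_eq_C_mul]; simp only [map_add, map_natCast, map_ofNat, Nat.sub_self,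
          Polynomial.bernoulli_zero]; push_cast; ring, map_add, map_smul, h4, bernoulli'_one,
          _root_.bernoulli_one, smul_eq_mul] at h
    have h6 : ((b : ℚ) + 2) ≠ 0 := by positivity
    rw [zero_add, zero_add, Nat.factorial_succ (b + 1)]
    have := Nat.factorial_ne_zero (b + 1)
    rw [← mul_right_inj' h6]
    push_cast
    field_simp
    simp only [Nat.factorial_one, Nat.cast_one]
    linarith
  | succ a ih =>
    have h := unitIntegral_derivative
      (Polynomial.bernoulli (a + 2) * Polynomial.bernoulli (b + 2))
    rw [derivative_mul, derivative_bernoulli_add_one, derivative_bernoulli_add_one] at h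
    simp only [eval_mul, bernoulli_eval_one, bernoulli_eval_zero] at h
    rw [← bernoulli_eq_bernoulli'_of_ne_one (by omega),
      ← bernoulli_eq_bernoulli'_of_ne_one (by omega), sub_self] at h
    rw [show (((a + 1 : ℕ) : ℚ[X]) + 1) * Polynomial.bernoulli (a + 1) *
          Polynomial.bernoulli (b + 2) +
        Polynomial.bernoulli (a + 2) * ((((b + 1 : ℕ) : ℚ[X]) + 1) * Polynomial.bernoulli (b + 1)) =
      ((a : ℚ) + 2) • (Polynomial.bernoulli (a + 1) * Polynomial.bernoulli (b + 1 + 1)) +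
        ((b : ℚ) + 2) • (Polynomial.bernoulli (a + 2) * Polynomial.bernoulli (b + 1)) by
        simp only [smul_eq_C_mul, map_add, map_natCast, map_ofNat]; push_cast; ring,
      map_add, map_smul, map_smul, ih, smul_eq_mul, smul_eq_mul] at h
    have h6 : ((b : ℚ) + 2) ≠ 0 := by positivity
    rw [← mul_right_inj' h6, eq_neg_of_add_eq_zero_right h,
      show a + (b + 1) + 2 = a + 1 + b + 2 by ring, Nat.factorial_succ (b + 1),
      Nat.factorial_succ (a + 1)]
    push_cast
    ring

lemma bernoulli_poly_div (a : ℕ) :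
    (1 / ((a : ℚ) + 1)) • Polynomial.bernoulli (a + 1) =
      monomial (a + 1) (1 / ((a : ℚ) + 1)) -
        ∑ l ∈ range (a + 1), monomial (a - l) ((a.choose l : ℚ) * zetaNeg l) := by
  have ha : (a : ℚ) + 1 ≠ 0 := by positivity
  rw [Polynomial.bernoulli, sum_range_succ', smul_add, smul_sum, sub_eq_add_neg, add_comm,
    ← sum_neg_distrib]
  congr 1
  · simp [smul_monomial]
  · refine sum_congr rfl fun l _ => ?_
    rw [smul_monomial, ← map_neg, show a + 1 - (l + 1) = a - l by omega]
    congr 1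
    have h2 : ((a : ℚ) + 1) * a.choose l = (a + 1).choose (l + 1) * (l + 1) := by
      exact_mod_cast Nat.add_one_mul_choose_eq a l
    have hl : (l : ℚ) + 1 ≠ 0 := by positivity
    rw [zetaNeg, smul_eq_mul]
    field_simp
    linear_combination (-bernoulli (l + 1)) * h2

/-- The products of two zeta values are packaged as a linear functional of (1+X)^a, so that later
sums over a can be carried out inside the polynomial ring. -/
lemma umbral_X_pow_mul_bernoulli (a b : ℕ) :
    umbral zetaNeg (X ^ b * ((1 / ((a : ℚ) + 1)) • Polynomial.bernoulli (a + 1))) =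
      zetaNeg (a + b + 1) * (1 / ((a : ℚ) + 1)) -
        umbral (fun l => zetaNeg l * zetaNeg (a + b - l)) ((1 + X) ^ a) := by
  rw [bernoulli_poly_div, mul_sub, map_sub, X_pow_mul_monomial, umbral_monomial, mul_sum, map_sum,
    add_comm (1 : ℚ[X]), add_pow, map_sum]
  congr 1
  · rw [mul_comm]; congr 2; ring
  · refine sum_congr rfl fun l hl => ?_
    have : l ≤ a := by simpa [Nat.lt_succ_iff] using hl
    rw [X_pow_mul_monomial, umbral_monomial, one_pow, mul_one, ← map_natCast (C : ℚ →+* ℚ[X]),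
      mul_comm (X ^ l), C_mul_X_pow_eq_monomial, umbral_monomial,
      show a - l + b = a + b - l by omega]
    ring

/-- With S_a = B_{a+1}(X)/(a+1) one has S_a(X+1) = S_a + X^a, so the difference of S_a S_b is X^b
S_a + X^a S_b + X^(a+b). This is the formal counterpart of splitting a double sum into its two
triangles and its diagonal. -/
lemma bernoulli_stuffle (a b : ℕ) :
    zetaNeg (a + b + 1) * (1 / ((a : ℚ) + 1)) -
        umbral (fun l => zetaNeg l * zetaNeg (a + b - l)) ((1 + X) ^ a) +
      (zetaNeg (a + b + 1) * (1 / ((b : ℚ) + 1)) -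
        umbral (fun l => zetaNeg l * zetaNeg (a + b - l)) ((1 + X) ^ b)) + zetaNeg (a + b) =
      -((-1) ^ a * (a.factorial * b.factorial / (a + b + 1).factorial) * zetaNeg (a + b + 1)) -
        zetaNeg a * zetaNeg b := by
  have ha : (a : ℚ) + 1 ≠ 0 := by positivity
  have hb : (b : ℚ) + 1 ≠ 0 := by positivity
  set S : ℕ → ℚ[X] := fun a => (1 / ((a : ℚ) + 1)) • Polynomial.bernoulli (a + 1) with hS
  have hcomp : ∀ a : ℕ, (S a).comp (1 + X) = S a + X ^ a := by
    intro a
    have ha : (a : ℚ) + 1 ≠ 0 := by positivity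
    simp only [hS]
    rw [smul_comp, bernoulli_comp_one_add_X, smul_add, Nat.add_sub_cancel, ← Nat.cast_smul_eq_nsmul ℚ,
      smul_smul]
    push_cast
    rw [one_div_mul_cancel ha, one_smul]
  have h := umbral_zetaNeg_shift (S a * S b)
  have e : (S a * S b).comp (1 + X) - S a * S b = X ^ b * S a + X ^ a * S b + X ^ (a + b) := by
    rw [mul_comp, hcomp, hcomp, pow_add]; ring
  have hI : unitIntegral (S a * S b) =
      -((-1) ^ a * (a.factorial * b.factorial / (a + b + 1).factorial) * zetaNeg (a + b + 1)) := by
    simp only [hS]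
    rw [smul_mul_smul_comm, map_smul, unitIntegral_bernoulli_mul, smul_eq_mul, zetaNeg,
      Nat.factorial_succ a, Nat.factorial_succ b, Nat.factorial_succ (a + b + 1)]
    have := Nat.factorial_ne_zero (a + b + 1)
    push_cast
    have h3 : (a : ℚ) + b + 1 + 1 ≠ 0 := by positivity
    field_simp
  have hE : (S a * S b).eval 0 = zetaNeg a * zetaNeg b := by
    simp only [hS, eval_mul, eval_smul, bernoulli_eval_zero, zetaNeg, smul_eq_mul]
    field_simp
  rw [e, hI, hE, map_add, map_add, umbral_X_pow, umbral_X_pow_mul_bernoulli,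
    umbral_X_pow_mul_bernoulli, add_comm b a] at h
  exact h

/-- Take a = N+k, b = 2N-k in the stuffle relation and sum against (-1)^k binom(N,k). Since a+b = 3N
is constant, the functionals do not depend on k, and every polynomial sum collapses to Y^N (1-Y)^N
with Y = X or Y = 1+X. -/
theorem sum_choose_zetaNeg_mul (N : ℕ) (hN : N ≠ 0) (hE : Even N) :
    ∑ k ∈ range (N + 1), (N.choose k : ℚ) * (zetaNeg (N + k) * zetaNeg (2 * N - k)) =
      (N.factorial : ℚ) ^ 2 / (2 * N + 1).factorial * zetaNeg (3 * N + 1) := by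
  set W := umbral fun l => zetaNeg l * zetaNeg (3 * N - l) with hW
  set Z := ∑ k ∈ range (N + 1), (N.choose k : ℚ) * (zetaNeg (N + k) * zetaNeg (2 * N - k)) with hZ
  set c : ℚ := (N.factorial : ℚ) ^ 2 / (2 * N + 1).factorial with hc
  have hneg1 : (-1 : ℚ) ^ N = 1 := hE.neg_one_pow
  have hbeta : unitIntegral (X ^ N * (1 - X) ^ N) = c := by
    rw [unitIntegral_beta, hc, two_mul, sq]
  have hsum : ∑ k ∈ range (N + 1), ((N.choose k : ℚ) * (-1) ^ k) *
      (zetaNeg (N + k + (2 * N - k) + 1) * (1 / (((N + k : ℕ) : ℚ) + 1)) -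
        umbral (fun l => zetaNeg l * zetaNeg (N + k + (2 * N - k) - l)) ((1 + X) ^ (N + k)) +
      (zetaNeg (N + k + (2 * N - k) + 1) * (1 / (((2 * N - k : ℕ) : ℚ) + 1)) -
        umbral (fun l => zetaNeg l * zetaNeg (N + k + (2 * N - k) - l)) ((1 + X) ^ (2 * N - k))) +
        zetaNeg (N + k + (2 * N - k))) =
      ∑ k ∈ range (N + 1), ((N.choose k : ℚ) * (-1) ^ k) *
      (-((-1) ^ (N + k) * ((N + k).factorial * (2 * N - k).factorial /
        (N + k + (2 * N - k) + 1).factorial) * zetaNeg (N + k + (2 * N - k) + 1)) -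
        zetaNeg (N + k) * zetaNeg (2 * N - k)) :=
    sum_congr rfl fun k _ => by rw [bernoulli_stuffle]
  have hexp : ∀ k ∈ range (N + 1), N + k + (2 * N - k) = 3 * N := fun k hk => by
    have := mem_range.mp hk; omega
  have hl : ∀ k ∈ range (N + 1), ((N.choose k : ℚ) * (-1) ^ k) *
      (zetaNeg (N + k + (2 * N - k) + 1) * (1 / (((N + k : ℕ) : ℚ) + 1)) -
        umbral (fun l => zetaNeg l * zetaNeg (N + k + (2 * N - k) - l)) ((1 + X) ^ (N + k)) +
      (zetaNeg (N + k + (2 * N - k) + 1) * (1 / (((2 * N - k : ℕ) : ℚ) + 1)) -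
        umbral (fun l => zetaNeg l * zetaNeg (N + k + (2 * N - k) - l)) ((1 + X) ^ (2 * N - k))) +
        zetaNeg (N + k + (2 * N - k))) =
      zetaNeg (3 * N + 1) * unitIntegral (((N.choose k : ℚ) * (-1) ^ k) • X ^ (N + k)) -
        W (((N.choose k : ℚ) * (-1) ^ k) • (1 + X) ^ (N + k)) +
      (zetaNeg (3 * N + 1) * unitIntegral (((N.choose k : ℚ) * (-1) ^ k) • X ^ (2 * N - k)) -
        W (((N.choose k : ℚ) * (-1) ^ k) • (1 + X) ^ (2 * N - k))) := by
    intro k hk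
    -- The diagonal term drops out because 3N is even and nonzero.
    rw [hexp k hk, zetaNeg_eq_zero_of_even (by omega : 3 * N ≠ 0) (hE.mul_left 3)]
    simp only [map_smul, smul_eq_mul, unitIntegral, umbral_X_pow, hW]
    ring
  have hr : ∀ k ∈ range (N + 1), ((N.choose k : ℚ) * (-1) ^ k) *
      (-((-1) ^ (N + k) * ((N + k).factorial * (2 * N - k).factorial /
        (N + k + (2 * N - k) + 1).factorial) * zetaNeg (N + k + (2 * N - k) + 1)) -
        zetaNeg (N + k) * zetaNeg (2 * N - k)) =
      -(zetaNeg (3 * N + 1) * unitIntegral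
        ((N.choose k : ℚ) • (X ^ (N + k) * (1 - X) ^ (2 * N - k)))) +
        (N.choose k : ℚ) * (zetaNeg (N + k) * zetaNeg (2 * N - k)) := by
    intro k hk
    rw [map_smul, unitIntegral_beta, hexp k hk, pow_add, hneg1, smul_eq_mul]
    -- The sign (-1)^k is harmless: for even k the product of zeta values is zero, for odd k it
    -- cancels the minus sign.
    rcases Nat.even_or_odd k with h | h
    · have h0 : zetaNeg (N + k) = 0 :=
        zetaNeg_eq_zero_of_even (by omega) (hE.add h)
      rw [h.neg_one_pow, h0]; ring
    · rw [h.neg_one_pow]; ring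
  rw [sum_congr rfl hl, sum_congr rfl hr] at hsum
  simp only [sum_add_distrib, sum_sub_distrib, ← mul_sum, ← map_sum, sum_neg_distrib, ← hZ] at hsum
  have p1 : ∀ Y : ℚ[X], ∑ k ∈ range (N + 1), ((N.choose k : ℚ) * (-1) ^ k) • Y ^ (N + k) =
      Y ^ N * (1 - Y) ^ N := by
    intro Y
    rw [sub_eq_neg_add, add_pow, mul_sum]
    refine sum_congr rfl fun k _ => ?_
    rw [smul_eq_C_mul, neg_pow, pow_add]
    simp only [map_mul, map_natCast, map_pow, map_neg, map_one, one_pow]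
    ring
  have p2 : ∀ Y : ℚ[X], ∑ k ∈ range (N + 1), ((N.choose k : ℚ) * (-1) ^ k) • Y ^ (2 * N - k) =
      Y ^ N * (1 - Y) ^ N := by
    intro Y
    rw [← neg_sub, hE.neg_pow, sub_eq_neg_add, add_pow, mul_sum]
    refine sum_congr rfl fun k hk => ?_
    have := mem_range.mp hk
    rw [smul_eq_C_mul, show 2 * N - k = N + (N - k) by omega, pow_add]
    simp only [map_mul, map_natCast, map_pow, map_neg, map_one]
    ring
  have p3 : ∑ k ∈ range (N + 1), (N.choose k : ℚ) • ((X : ℚ[X]) ^ (N + k) * (1 - X) ^ (2 * N - k)) =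
      X ^ N * (1 - X) ^ N := by
    have := add_pow (X : ℚ[X]) (1 - X) N
    rw [add_sub_cancel, one_pow] at this
    have h : (X : ℚ[X]) ^ N * (1 - X) ^ N = X ^ N * (1 - X) ^ N *
        ∑ k ∈ range (N + 1), X ^ k * (1 - X) ^ (N - k) * (N.choose k : ℚ[X]) := by
      rw [← this, mul_one]
    rw [h, mul_sum]
    refine sum_congr rfl fun k hk => ?_
    have := mem_range.mp hk
    rw [smul_eq_C_mul, show 2 * N - k = N + (N - k) by omega, pow_add, pow_add]
    simp only [map_natCast]
    ring
  -- As N is even the polynomial is X^N (1+X)^N, whose binomial expansion runs over the exponents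
  -- N+k.
  have p4 : W ((1 + X) ^ N * (1 - (1 + X)) ^ N) = Z := by
    rw [sub_add_cancel_left, hE.neg_pow, mul_comm, add_comm (1 : ℚ[X]), add_pow, mul_sum, map_sum]
    refine sum_congr rfl fun k hk => ?_
    have := mem_range.mp hk
    rw [one_pow, mul_one, ← mul_assoc, ← pow_add, ← map_natCast (C : ℚ →+* ℚ[X]), mul_comm,
      C_mul_X_pow_eq_monomial, hW, umbral_monomial, show 3 * N - (N + k) = 2 * N - k by omega]
  -- What remains is 2(cζ - Z) = -(cζ - Z), with ζ standing for `zetaNeg (3 * N + 1)`.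
  rw [p1, p1, p2, p2, p3, p4, hbeta] at hsum
  linarith

end BernoulliNumbers

end WittenZeta

namespace WittenZeta

/-! ### Geometric decay of the coefficients ζ(s-n)/n!. -/

section ZetaCoefficients

open Complex Set

/-- The coefficient `(-1)^n ζ(s-n) / n!` of `t^n` in the expansion of `Li_s(e^{-t})` at `t = 0`. -/
noncomputable def zetaCoeff (n : ℕ) (s : ℂ) : ℂ :=
  (-1) ^ n * riemannZeta (s - n) / n.factorial

lemma differentiableOn_zetaCoeff (n : ℕ) : DifferentiableOn ℂ (zetaCoeff n) {s | s.re < 1} := by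
  intro s hs
  have h1 : s - n ≠ 1 := by
    intro h
    have := congrArg re h
    simp only [sub_re, natCast_re, one_re] at this
    have h0 : (0 : ℝ) ≤ n := n.cast_nonneg
    simp only [mem_ofPred_eq] at hs
    linarith
  have h2 : DifferentiableAt ℂ (fun s : ℂ => riemannZeta (s - n)) s :=
    (differentiableAt_riemannZeta h1).comp (f := fun s : ℂ => s - n) s (by fun_prop)
  exact ((h2.const_mul _).div_const _).differentiableWithinAt

lemma norm_Gamma_le_Gamma_re {w : ℂ} (hw : 0 < w.re) : ‖Gamma w‖ ≤ Real.Gamma w.re := by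
  rw [Gamma_eq_integral hw, Real.Gamma_eq_integral hw, GammaIntegral]
  refine (MeasureTheory.norm_integral_le_integral_norm _).trans (le_of_eq ?_)
  refine MeasureTheory.setIntegral_congr_fun measurableSet_Ioi fun x hx => ?_
  simp only [norm_mul, norm_cpow_eq_rpow_re_of_pos (mem_Ioi.mp hx), sub_re, one_re]
  rw [Complex.norm_of_nonneg (Real.exp_pos _).le]

lemma norm_cos_le_exp_abs_im (z : ℂ) : ‖cos z‖ ≤ Real.exp |z.im| := by
  rw [Complex.cos, norm_div, RCLike.norm_ofNat, div_le_iff₀ two_pos]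
  refine (norm_add_le _ _).trans ?_
  rw [norm_exp, norm_exp]
  have h1 : Real.exp (z * I).re ≤ Real.exp |z.im| := by
    apply Real.exp_le_exp.mpr; simpa using neg_le_abs z.im
  have h2 : Real.exp (-z * I).re ≤ Real.exp |z.im| := by
    apply Real.exp_le_exp.mpr; simpa using le_abs_self z.im
  linarith

lemma norm_riemannZeta_le {a : ℝ} (ha : 1 < a) {w : ℂ} (hw : a ≤ w.re) :
    ‖riemannZeta w‖ ≤ ∑' n : ℕ, 1 / (n : ℝ) ^ a := by
  have hs := Real.summable_one_div_nat_rpow.mpr ha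
  rw [zeta_eq_tsum_one_div_nat_cpow (ha.trans_le hw)]
  refine tsum_of_norm_bounded hs.hasSum fun n => ?_
  rcases Nat.eq_zero_or_pos n with rfl | hn
  · have h1 : w ≠ 0 := by rintro rfl; simp at hw; linarith
    simp [h1, (by linarith : a ≠ 0)]
  · rw [norm_div, norm_one, norm_natCast_cpow_of_pos hn]
    have : (1 : ℝ) ≤ n := by exact_mod_cast hn
    gcongr

/-- By the functional equation at w = 1-s+n: (2π)^(-w) contributes at most 4^(-n) and Γ(w) at most
2^(n+M) n! M!, while the cosine and ζ(w) stay bounded. The bound n ≥ 2 puts Re w in [2, ∞), where Γ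
is monotone. -/
lemma norm_zetaCoeff_le {n : ℕ} (hn : 2 ≤ n) {s : ℂ} {M : ℕ} {δ : ℝ} (hδ : 0 < δ)
    (hs : s.re ≤ 1 - δ) (hM : ‖s‖ ≤ M) :
    ‖zetaCoeff n s‖ ≤ (2 * 2 ^ M * M.factorial * Real.exp (Real.pi * M) *
      ∑' n : ℕ, 1 / (n : ℝ) ^ (1 + δ)) * (1 / 2) ^ n := by
  set Z := ∑' n : ℕ, 1 / (n : ℝ) ^ (1 + δ)
  have hre := (abs_le.mp ((abs_re_le_norm s).trans hM)).1
  have him := (abs_im_le_norm s).trans hM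
  have hn' : (2 : ℝ) ≤ n := by exact_mod_cast hn
  set w : ℂ := 1 - s + n with hw
  have hwre : w.re = 1 - s.re + n := by simp [hw]
  have h1 : riemannZeta (s - n) =
      2 * (2 * Real.pi) ^ (-w) * Gamma w * cos (Real.pi * w / 2) * riemannZeta w := by
    rw [← riemannZeta_one_sub]
    · congr 1; rw [hw]; ring
    · intro m h
      have := congrArg re h
      rw [hwre] at this
      simp only [neg_re, natCast_re] at this
      have : (0 : ℝ) ≤ m := m.cast_nonneg
      linarith
    · intro h
      have := congrArg re h
      rw [hwre, one_re] at this
      linarith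
  have hζ : ‖riemannZeta w‖ ≤ Z := norm_riemannZeta_le (by linarith) (by rw [hwre]; linarith)
  have hcos : ‖cos (Real.pi * w / 2)‖ ≤ Real.exp (Real.pi * M) := by
    refine (norm_cos_le_exp_abs_im _).trans (Real.exp_le_exp.mpr ?_)
    have : (Real.pi * w / 2 : ℂ).im = -(Real.pi / 2 * s.im) := by
      rw [show (Real.pi * w / 2 : ℂ) = ((Real.pi / 2 : ℝ) : ℂ) * w by push_cast; ring, im_ofReal_mul]
      simp [hw]
    rw [this, abs_neg, abs_mul, abs_of_pos (by positivity)]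
    have := Real.pi_pos
    have h0 := abs_nonneg s.im
    nlinarith
  have hG : ‖Gamma w‖ ≤ 2 ^ n * 2 ^ M * n.factorial * M.factorial := by
    refine (norm_Gamma_le_Gamma_re (by rw [hwre]; linarith)).trans ?_
    have h2 : Real.Gamma w.re ≤ Real.Gamma ((n + M : ℕ) + 1) := by
      refine Real.Gamma_strictMonoOn_Ici.monotoneOn ?_ ?_ ?_
      · rw [mem_Ici, hwre]; linarith
      · rw [mem_Ici]; push_cast; have : (0 : ℝ) ≤ M := M.cast_nonneg
        linarith
      · rw [hwre]; push_cast; linarith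
    refine h2.trans ?_
    rw [Real.Gamma_nat_eq_factorial]
    have h3 : (n + M).factorial ≤ 2 ^ n * 2 ^ M * n.factorial * M.factorial := by
      rw [← pow_add, ← Nat.add_choose_mul_factorial_mul_factorial]
      gcongr
      exact Nat.choose_le_two_pow _ _
    exact_mod_cast h3
  have hpi : ‖(2 * Real.pi : ℂ) ^ (-w)‖ ≤ (1 / 4) ^ n := by
    have h4 : (2 * Real.pi : ℂ) = ((2 * Real.pi : ℝ) : ℂ) := by push_cast; rfl
    have h5 : 4 ≤ 2 * Real.pi := by linarith [Real.pi_gt_three]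
    rw [h4, norm_cpow_eq_rpow_re_of_pos (by linarith), neg_re, Real.rpow_neg (by linarith), one_div,
      inv_pow]
    gcongr
    rw [← Real.rpow_natCast]
    calc (4 : ℝ) ^ (n : ℝ) ≤ (2 * Real.pi) ^ (n : ℝ) := by gcongr
      _ ≤ _ := by
        apply Real.rpow_le_rpow_of_exponent_le (by linarith)
        rw [hwre]; linarith
  have hfac : (0 : ℝ) < n.factorial := by exact_mod_cast n.factorial_pos
  rw [zetaCoeff, norm_div, norm_mul, norm_pow, norm_neg, norm_one, one_pow, one_mul, h1, Complex.norm_natCast,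
    div_le_iff₀ hfac]
  simp only [norm_mul, RCLike.norm_ofNat]
  calc 2 * ‖(2 * Real.pi : ℂ) ^ (-w)‖ * ‖Gamma w‖ * ‖cos (Real.pi * w / 2)‖ * ‖riemannZeta w‖
      ≤ 2 * (1 / 4) ^ n * (2 ^ n * 2 ^ M * n.factorial * M.factorial) * Real.exp (Real.pi * M) * Z := by
        gcongr
    _ = _ := by
      have : (1 / 4 : ℝ) ^ n * 2 ^ n = (1 / 2) ^ n := by rw [← mul_pow]; norm_num
      rw [← this]; ring

lemma exists_zetaCoeff_bound {K : Set ℂ} (hK : IsCompact K) (hK' : K ⊆ {s | s.re < 1}) :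
    ∃ C : ℝ, 0 ≤ C ∧ ∀ n, ∀ s ∈ K, ‖zetaCoeff n s‖ ≤ C * (1 / 2) ^ n := by
  rcases K.eq_empty_or_nonempty with rfl | hne
  · exact ⟨0, le_rfl, by simp⟩
  have hb : ∀ n, ∃ C, ∀ s ∈ K, ‖zetaCoeff n s‖ ≤ C := fun n =>
    hK.exists_bound_of_continuousOn ((differentiableOn_zetaCoeff n).continuousOn.mono hK')
  obtain ⟨C0, h0⟩ := hb 0
  obtain ⟨C1, h1⟩ := hb 1
  obtain ⟨R, hR⟩ := hK.exists_bound_of_continuousOn (f := id) continuousOn_id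
  obtain ⟨M, hM⟩ := exists_nat_ge R
  obtain ⟨x, hx, hmax⟩ := hK.exists_isMaxOn hne continuous_re.continuousOn
  have hx1 : x.re < 1 := hK' hx
  set B := (2 * 2 ^ M * M.factorial * Real.exp (Real.pi * M) *
      ∑' n : ℕ, 1 / (n : ℝ) ^ (1 + (1 - x.re))) with hB
  have hBnn : 0 ≤ B := by
    have : 0 ≤ ∑' n : ℕ, 1 / (n : ℝ) ^ (1 + (1 - x.re)) := tsum_nonneg fun n => by positivity
    positivity
  -- The last two summands cover n = 1 (the 2 undoing the factor 1/2) and n = 0, bounded by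
  -- compactness alone.
  refine ⟨B + 2 * |C1| + |C0|, by positivity, fun n s hs => ?_⟩
  have a0 := abs_nonneg C0
  have a1 := abs_nonneg C1
  match n with
  | 0 =>
    have := (h0 s hs).trans (le_abs_self _)
    simp only [pow_zero, mul_one]; linarith
  | 1 =>
    have := (h1 s hs).trans (le_abs_self _)
    rw [pow_one]; linarith
  | n + 2 =>
    have hsre : s.re ≤ x.re := hmax hs
    refine (norm_zetaCoeff_le (by omega) (sub_pos.mpr hx1) (s := s) (by linarith)
      ((hR s hs).trans hM)).trans ?_
    gcongr
    linarith

end ZetaCoefficients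

end WittenZeta

namespace WittenZeta

/-! ### Lipschitz's formula via Poisson summation. -/

section Lipschitz

open Complex Set MeasureTheory

/-- The integrand of the Laplace transform of `x ^ (a - 1)`. -/
lemma norm_cpow_mul_exp_neg_mul {a r : ℂ} {x : ℝ} (hx : 0 < x) :
    ‖(x : ℂ) ^ (a - 1) * exp (-(r * x))‖ = x ^ (a.re - 1) * Real.exp (-r.re * x) := by
  rw [norm_mul, norm_cpow_eq_rpow_re_of_pos hx, norm_exp]
  simp

lemma integrableOn_rpow_mul_exp_neg_mul {p b : ℝ} (hp : -1 < p) (hb : 0 < b) :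
    IntegrableOn (fun x : ℝ => x ^ p * Real.exp (-b * x)) (Ioi 0) := by
  simpa using integrableOn_rpow_mul_exp_neg_mul_rpow hp one_pos hb

lemma aestronglyMeasurable_cpow_mul_exp (a r : ℂ) :
    AEStronglyMeasurable (fun x : ℝ => (x : ℂ) ^ (a - 1) * exp (-(r * x)))
      (volume.restrict (Ioi 0)) := by
  refine ContinuousOn.aestronglyMeasurable (fun x hx => ?_) measurableSet_Ioi
  refine ContinuousAt.continuousWithinAt (ContinuousAt.mul ?_ (by fun_prop))
  exact continuousAt_ofReal_cpow_const _ _ (Or.inr (ne_of_gt hx))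

lemma integrableOn_cpow_mul_exp {a r : ℂ} (ha : 0 < a.re) (hr : 0 < r.re) :
    IntegrableOn (fun x : ℝ => (x : ℂ) ^ (a - 1) * exp (-(r * x))) (Ioi 0) := by
  refine (integrableOn_rpow_mul_exp_neg_mul (p := a.re - 1) (by linarith) hr).mono'
    (aestronglyMeasurable_cpow_mul_exp a r) ?_
  filter_upwards [ae_restrict_mem measurableSet_Ioi] with x hx
  rw [norm_cpow_mul_exp_neg_mul hx]

/-- The Laplace transform of `x ^ (a - 1)` at a complex argument. -/
lemma laplace_cpow {a r : ℂ} (ha : 0 < a.re) (hr : 0 < r.re) :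
    ∫ x in Ioi (0 : ℝ), (x : ℂ) ^ (a - 1) * exp (-(r * x)) = Gamma a * r ^ (-a) := by
  -- The formula is known for real r > 0; both sides are holomorphic in r on the right half-plane,
  -- so the identity theorem extends it.
  have hU : IsOpen {r : ℂ | 0 < r.re} := isOpen_lt continuous_const continuous_re
  have hL : DifferentiableOn ℂ
      (fun r : ℂ => ∫ x in Ioi (0 : ℝ), (x : ℂ) ^ (a - 1) * exp (-(r * x))) {r | 0 < r.re} := by
    intro r hr
    have hr : 0 < r.re := hr
    have hnhds : {z : ℂ | r.re / 2 < z.re} ∈ 𝓝 r :=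
      (isOpen_lt continuous_const continuous_re).mem_nhds (by simp; linarith)
    have h := hasDerivAt_integral_of_dominated_loc_of_deriv_le
      (μ := volume.restrict (Ioi (0 : ℝ)))
      (F := fun (r : ℂ) (x : ℝ) => (x : ℂ) ^ (a - 1) * exp (-(r * x)))
      (F' := fun (r : ℂ) (x : ℝ) => -((x : ℂ) ^ (a + 1 - 1) * exp (-(r * x))))
      (bound := fun x => x ^ a.re * Real.exp (-(r.re / 2) * x)) hnhds
      (Eventually.of_forall fun z => aestronglyMeasurable_cpow_mul_exp a z)
      (integrableOn_cpow_mul_exp ha hr) (aestronglyMeasurable_cpow_mul_exp (a + 1) r).neg ?_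
      (integrableOn_rpow_mul_exp_neg_mul (by linarith) (by linarith)) ?_
    · exact h.2.differentiableAt.differentiableWithinAt
    · filter_upwards [ae_restrict_mem measurableSet_Ioi] with x hx z hz
      have hx : 0 < x := hx
      have hz : r.re / 2 < z.re := hz
      rw [norm_neg, norm_cpow_mul_exp_neg_mul hx]
      simp only [add_re, one_re, add_sub_cancel_right]
      gcongr
    · filter_upwards [ae_restrict_mem measurableSet_Ioi] with x hx z _
      have hx : (x : ℂ) ≠ 0 := by exact_mod_cast (ne_of_gt hx)
      have h1 : HasDerivAt (fun z : ℂ => -(z * x)) (-(1 * x)) z :=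
        ((hasDerivAt_id z).mul_const _).neg
      convert! h1.cexp.const_mul ((x : ℂ) ^ (a - 1)) using 1
      rw [add_sub_cancel_right, cpow_sub _ _ hx, cpow_one]
      field_simp
  have hR : DifferentiableOn ℂ (fun r : ℂ => Gamma a * r ^ (-a)) {r | 0 < r.re} := by
    intro r hr
    refine (DifferentiableAt.const_mul ?_ _).differentiableWithinAt
    exact differentiableAt_id.cpow_const (Or.inl hr)
  refine AnalyticOnNhd.eqOn_of_preconnected_of_frequently_eq (z₀ := 1) (hL.analyticOnNhd hU)
    (hR.analyticOnNhd hU) (convex_halfSpace_re_gt 0).isPreconnected (by simp) ?_ hr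
  have hfreq : ∃ᶠ x : ℝ in 𝓝[≠] (1 : ℝ), 0 < x :=
    (eventually_nhdsWithin_of_eventually_nhds (lt_mem_nhds one_pos)).frequently
  have htend : Tendsto (fun x : ℝ => (x : ℂ)) (𝓝[≠] 1) (𝓝[≠] 1) := by
    refine tendsto_nhdsWithin_iff.mpr ⟨?_, ?_⟩
    · exact_mod_cast (continuous_ofReal.tendsto 1).mono_left nhdsWithin_le_nhds
    · filter_upwards [self_mem_nhdsWithin] with x hx
      simpa using hx
  refine htend.frequently (hfreq.mono fun x hx => ?_)
  rw [integral_cpow_mul_exp_neg_mul_Ioi ha hx, mul_comm, one_div, cpow_neg, inv_cpow]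
  rw [arg_ofReal_of_nonneg hx.le]
  exact Real.pi_pos.ne

/-- Binomial expansion of `(t + z) ^ (-w)` for `z` in the closed right half plane. -/
lemma hasSum_add_cpow {z t w : ℂ} (hz : 0 ≤ z.re) (h : ‖t‖ < ‖z‖) :
    HasSum (fun r : ℕ => Ring.choose (-w) r * t ^ r * z ^ (-(w + r))) ((t + z) ^ (-w)) := by
  have hz0 : z ≠ 0 := norm_pos_iff.mp ((norm_nonneg t).trans_lt h)
  have h1 : ‖t / z‖ < 1 := by rw [norm_div, div_lt_one (norm_pos_iff.mpr hz0)]; exact h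
  have h2 := (one_add_cpow_hasFPowerSeriesOnBall_zero (a := -w)).hasSum (y := t / z)
    (by simpa [Metric.mem_eball, edist_zero_right, ← ofReal_norm] using h1)
  have hre : 0 < (1 + t / z).re := by
    have := (abs_le.mp (abs_re_le_norm (t / z))).1
    simp only [add_re, one_re]; linarith
  have h3 : 1 + t / z ≠ 0 := by intro h; rw [h] at hre; simp at hre
  -- The principal logarithm is additive here: |arg z| ≤ π/2 and |arg(1 + t/z)| < π/2. The closed
  -- half-plane matters, since the frequencies used later are purely imaginary.
  have h4 : (t + z) ^ (-w) = z ^ (-w) * (1 + t / z) ^ (-w) := by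
    have e : t + z = z * (1 + t / z) := by field_simp; ring
    have hA := abs_le.mp (abs_arg_le_pi_div_two_iff.mpr hz)
    have hB := abs_lt.mp (abs_arg_lt_pi_div_two_iff.mpr (Or.inl hre))
    rw [e, cpow_def_of_ne_zero (mul_ne_zero hz0 h3), log_mul hz0 h3 ⟨by linarith, by linarith⟩,
      add_mul, exp_add, cpow_def_of_ne_zero hz0, cpow_def_of_ne_zero h3]
  rw [h4]
  rw [zero_add] at h2
  refine (h2.mul_left (z ^ (-w))).congr_fun fun r => ?_
  rw [binomialSeries_apply, neg_add, cpow_add _ _ hz0, cpow_neg z (r : ℂ), cpow_natCast]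
  simp only [List.ofFn_const, List.prod_replicate, smul_eq_mul, div_pow]
  ring

/-- Converts the binomial coefficients into the Gamma factors occurring in the functional equation
of ζ at w+r. -/
lemma Gamma_mul_choose {w : ℂ} (hw : 0 < w.re) (r : ℕ) :
    Gamma w * Ring.choose (-w) r = (-1) ^ r / r.factorial * Gamma (w + r) := by
  induction r with
  | zero => simp
  | succ r ih =>
    have h1 : ((r : ℂ) + 1) * Ring.choose (-w) (r + 1) = Ring.choose (-w) r * (-w - r) := by
      rw [Ring.choose_eq_smul, Ring.choose_eq_smul, descPochhammer_succ_right,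
        Polynomial.smeval_mul, Polynomial.smeval_sub, Polynomial.smeval_X,
        Polynomial.smeval_natCast, Nat.factorial_succ]
      have := Nat.factorial_ne_zero r
      have hr : (r : ℂ) + 1 ≠ 0 := by exact_mod_cast r.succ_ne_zero
      push_cast
      simp only [smul_eq_mul, pow_one, pow_zero, nsmul_eq_mul, mul_one]
      field_simp
    have hr : (r : ℂ) + 1 ≠ 0 := by exact_mod_cast r.succ_ne_zero
    have hwr : w + r ≠ 0 := by
      intro h
      have := congrArg re h
      simp only [add_re, natCast_re, zero_re] at this
      have h0 : (0 : ℝ) ≤ r := r.cast_nonneg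
      linarith
    push_cast
    rw [← add_assoc, Gamma_add_one _ hwr, Nat.factorial_succ, pow_succ, ← mul_right_inj' hr]
    have h2 : ((r : ℂ) + 1) * (Gamma w * Ring.choose (-w) (r + 1)) =
        (Gamma w * Ring.choose (-w) r) * (-w - r) := by rw [mul_left_comm, h1]; ring
    rw [h2, ih]
    push_cast
    field_simp
    ring

/-- The polylogarithm `Li_s(e^{-t})`. -/
noncomputable def polyLog (s : ℂ) (t : ℝ) : ℂ := ∑' k : ℕ+, ((k : ℕ) : ℂ) ^ (-s) * exp (-(k * t))

lemma summable_cpow_int (t : ℝ) {w : ℂ} (hw : 1 < w.re) :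
    Summable fun n : ℤ => ((t : ℂ) + 2 * Real.pi * n * I) ^ (-w) := by
  refine Summable.of_norm_bounded_eventually
    ((Real.summable_abs_int_rpow hw).mul_right (Real.exp (Real.pi * |w.im|))) ?_
  have : ∀ᶠ n : ℤ in cofinite, n ≠ 0 := by
    rw [eventually_cofinite]; simp
  filter_upwards [this] with n hn
  refine (norm_cpow_le _ _).trans ?_
  rw [div_eq_mul_inv, ← Real.exp_neg, neg_re]
  have h1 : |(n : ℝ)| ≤ ‖(t : ℂ) + 2 * Real.pi * n * I‖ := by
    have h2 := abs_im_le_norm ((t : ℂ) + 2 * Real.pi * n * I)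
    have h3 : ((t : ℂ) + 2 * Real.pi * n * I).im = 2 * Real.pi * n := by simp
    rw [h3, abs_mul] at h2
    refine le_trans ?_ h2
    rw [abs_of_pos Real.two_pi_pos]
    have := Real.pi_gt_three
    have := abs_nonneg (n : ℝ)
    nlinarith
  have hpos : 0 < |(n : ℝ)| := by positivity
  gcongr ?_ * Real.exp ?_
  · exact Real.rpow_le_rpow_of_nonpos hpos h1 (by linarith)
  · rw [neg_im]
    set θ := arg ((t : ℂ) + 2 * Real.pi * n * I)
    calc -(θ * -w.im) = θ * w.im := by ring
      _ ≤ |θ * w.im| := le_abs_self _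
      _ = |θ| * |w.im| := abs_mul _ _
      _ ≤ _ := by gcongr; exact abs_arg_le_pi _

/-- Lipschitz's summation formula. -/
theorem polyLog_eq_tsum_int {t : ℝ} (ht : 0 < t) {w : ℂ} (hw : 1 < w.re) :
    polyLog (1 - w) t = Gamma w * ∑' n : ℤ, ((t : ℂ) + 2 * Real.pi * n * I) ^ (-w) := by
  -- Truncation by `max x 0` extends x^(w-1) e^{-tx} by zero to the whole line; Re w > 1 keeps the
  -- extension continuous at 0, as Poisson summation needs.
  set f : ℝ → ℂ := fun x => ((max x 0 : ℝ) : ℂ) ^ (w - 1) * exp (-(t * x)) with hf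
  have hw1 : 0 < (w - 1).re := by simp; linarith
  have hw0 : w - 1 ≠ 0 := by intro h; rw [h] at hw1; simp at hw1
  have hfneg : ∀ x ≤ 0, f x = 0 := fun x hx => by
    simp [hf, max_eq_right hx, zero_cpow hw0]
  have hc : Continuous f :=
    ((continuous_ofReal_cpow_const hw1).comp (continuous_id.max continuous_const)).mul
      (by fun_prop)
  have hO : f =O[cocompact ℝ] fun x : ℝ => |x| ^ (-2 : ℝ) := by
    rw [cocompact_eq_atBot_atTop, Asymptotics.isBigO_sup]
    constructor
    · refine Asymptotics.IsBigO.of_bound 0 ?_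
      filter_upwards [eventually_le_atBot 0] with x hx
      simp [hfneg x hx]
    · have h1 := (isLittleO_exp_neg_mul_rpow_atTop ht (-2 - (w.re - 1))).isBigO
      have h2 := (Asymptotics.isBigO_refl (fun x : ℝ => x ^ (w.re - 1)) atTop).mul h1
      refine Asymptotics.IsBigO.trans (Asymptotics.IsBigO.of_bound 1 ?_)
        (h2.trans (Asymptotics.IsBigO.of_bound 1 ?_))
      · filter_upwards [eventually_gt_atTop 0] with x hx
        simp only [hf]
        rw [max_eq_left hx.le, norm_cpow_mul_exp_neg_mul (r := t) hx, ofReal_re, one_mul,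
          Real.norm_of_nonneg (by positivity)]
      · filter_upwards [eventually_gt_atTop 0] with x hx
        rw [abs_of_pos hx, ← Real.rpow_add hx, one_mul]
        ring_nf
        exact le_rfl
  have hF : ∀ n : ℤ, FourierTransform.fourier f (n : ℝ) =
      Gamma w * ((t : ℂ) + 2 * Real.pi * n * I) ^ (-w) := by
    intro n
    rw [Real.fourier_real_eq_integral_exp_smul,
      ← laplace_cpow (a := w) (by linarith) (by simpa using ht),
      ← setIntegral_eq_integral_of_forall_compl_eq_zero (s := Ioi 0)]
    · refine setIntegral_congr_fun measurableSet_Ioi fun x hx => ?_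
      have hx : 0 < x := hx
      simp only [hf, smul_eq_mul, max_eq_left hx.le]
      rw [mul_left_comm, ← exp_add]
      congr 2
      push_cast
      ring
    · intro x hx
      rw [hfneg x (not_lt.mp hx), smul_zero]
  have hP := Real.tsum_eq_tsum_fourier_of_rpow_decay_of_summable hc one_lt_two hO
    (by simp only [hF]; exact (summable_cpow_int t hw).mul_left _) 0
  simp only [hF, zero_add, QuotientAddGroup.mk_zero, fourier_eval_zero, mul_one] at hP
  rw [tsum_mul_left] at hP
  rw [← hP, polyLog, ← Function.Injective.tsum_eq (g := fun k : ℕ+ => ((k : ℕ) : ℤ))]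
  · refine tsum_congr fun k => ?_
    simp only [hf]
    rw [max_eq_left (by positivity), neg_sub]
    push_cast
    rw [mul_comm (t : ℂ)]
  · intro a b h
    exact PNat.coe_injective (Int.ofNat_inj.mp h)
  · intro n hn
    by_contra h
    refine hn (hfneg _ ?_)
    by_contra h'
    push Not at h'
    have h' : 0 < n := by exact_mod_cast h'
    exact h ⟨⟨n.toNat, by omega⟩, by simp; omega⟩

end Lipschitz

end WittenZeta

namespace WittenZeta

/-! ### Expansion of the polylogarithm at t = 0. -/

section PolyLogExpansion

open Complex Set

lemma ofReal_mul_I_cpow_add {x : ℝ} (hx : 0 < x) (v : ℂ) :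
    ((x : ℂ) * I) ^ (-v) + (-((x : ℂ) * I)) ^ (-v) =
      (x : ℂ) ^ (-v) * (2 * cos (Real.pi * v / 2)) := by
  have hx' : (x : ℂ) ≠ 0 := by exact_mod_cast hx.ne'
  rw [← mul_neg, cpow_def_of_ne_zero (mul_ne_zero hx' I_ne_zero),
    cpow_def_of_ne_zero (mul_ne_zero hx' (neg_ne_zero.mpr I_ne_zero)), cpow_def_of_ne_zero hx',
    log_ofReal_mul hx I_ne_zero, log_ofReal_mul hx (neg_ne_zero.mpr I_ne_zero), log_I, log_neg_I,
    two_cos, mul_add, ← exp_add, ← exp_add, ofReal_log hx.le, add_comm]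
  congr 2 <;> ring

/-- Sum of the binomial terms attached to a pair of conjugate frequencies. -/
lemma frequency_pair (v : ℂ) (n : ℕ) :
    (((2 * Real.pi * (n + 1) : ℝ) : ℂ) * I) ^ (-v) + (-(((2 * Real.pi * (n + 1) : ℝ) : ℂ) * I)) ^ (-v) =
      (2 * Real.pi) ^ (-v) * (2 * cos (Real.pi * v / 2)) * (1 / ((n : ℂ) + 1) ^ v) := by
  rw [ofReal_mul_I_cpow_add (by positivity), ofReal_mul,
    mul_cpow_ofReal_nonneg Real.two_pi_pos.le (by positivity), cpow_neg (((n + 1 : ℝ)) : ℂ)]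
  push_cast
  ring

/-- The `r`-th binomial term attached to the frequencies `± 2 π (n + 1)`. -/
noncomputable def frequencyTerm (w : ℂ) (t : ℝ) (n r : ℕ) : ℂ :=
  Ring.choose (-w) r * (t : ℂ) ^ r *
      ((2 * Real.pi) ^ (-(w + r)) * (2 * cos (Real.pi * (w + r) / 2)) *
        (1 / ((n : ℂ) + 1) ^ (w + r)))

lemma summable_frequency {w : ℂ} (hw : 1 < w.re) {t : ℝ} (ht : 0 < t) (ht' : t ≤ 1) :
    Summable (Function.uncurry (frequencyTerm w t)) := by
  have h1 : Summable fun n : ℕ => 1 / ((n : ℝ) + 1) ^ w.re := by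
    have := (summable_nat_add_iff 1).mpr (Real.summable_one_div_nat_rpow.mpr hw)
    simpa using this
  -- This is absolute convergence of the binomial series of (1 + 1/2)^(-w); the factor (2π)^(-r)
  -- supplies the 2^(-r).
  have h2 : Summable fun r : ℕ => ‖Ring.choose (-w) r‖ * (1 / 2) ^ r := by
    have := (hasSum_add_cpow (z := 1) (t := 1 / 2) (w := w) (by simp) (by norm_num)).summable.norm
    refine this.congr fun r => ?_
    rw [norm_mul, norm_mul, one_cpow, norm_one, mul_one, norm_pow]
    norm_num
  refine Summable.of_norm_bounded
    ((h1.mul_of_nonneg h2 (fun n => by positivity) (fun r => by positivity)).mul_right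
      (2 * Real.exp (Real.pi * |w.im|))) ?_
  rintro ⟨n, r⟩
  simp only [Function.uncurry_apply_pair, frequencyTerm, norm_mul, norm_div, norm_one, norm_pow, norm_real,
    RCLike.norm_ofNat]
  have hπ := Real.pi_gt_three
  have e1 : ‖(2 * Real.pi : ℂ) ^ (-(w + r))‖ ≤ (1 / 2) ^ r := by
    have h4 : (2 * Real.pi : ℂ) = ((2 * Real.pi : ℝ) : ℂ) := by push_cast; rfl
    rw [h4, norm_cpow_eq_rpow_re_of_pos (by linarith), neg_re, Real.rpow_neg (by linarith), one_div,
      inv_pow]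
    gcongr
    rw [← Real.rpow_natCast]
    calc (2 : ℝ) ^ (r : ℝ) ≤ (2 * Real.pi) ^ (r : ℝ) := by gcongr; linarith
      _ ≤ _ := by
        apply Real.rpow_le_rpow_of_exponent_le (by linarith)
        simp only [add_re, natCast_re]; linarith
  have e2 : ‖cos (Real.pi * (w + r) / 2)‖ ≤ Real.exp (Real.pi * |w.im|) := by
    refine (norm_cos_le_exp_abs_im _).trans (Real.exp_le_exp.mpr ?_)
    rw [show (Real.pi * (w + r) / 2 : ℂ) = ((Real.pi / 2 : ℝ) : ℂ) * (w + r) by push_cast; ring,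
      im_ofReal_mul, abs_mul, abs_of_pos (by positivity)]
    simp only [add_im, natCast_im, add_zero]
    have h0 := abs_nonneg w.im
    nlinarith
  have e3 : 1 / ‖((n : ℂ) + 1) ^ (w + r)‖ ≤ 1 / ((n : ℝ) + 1) ^ w.re := by
    have h4 : ((n : ℂ) + 1) = ((n + 1 : ℝ) : ℂ) := by push_cast; rfl
    rw [h4, norm_cpow_eq_rpow_re_of_pos (by positivity)]
    refine one_div_le_one_div_of_le (by positivity) (Real.rpow_le_rpow_of_exponent_le ?_ ?_)
    · linarith [(n.cast_nonneg : (0 : ℝ) ≤ n)]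
    · simp
  have e4 : ‖t‖ ^ r ≤ 1 := by
    rw [Real.norm_of_nonneg ht.le]; exact pow_le_one₀ ht.le ht'
  calc _ ≤ ‖Ring.choose (-w) r‖ * 1 * ((1 / 2) ^ r * (2 * Real.exp (Real.pi * |w.im|)) *
        (1 / ((n : ℝ) + 1) ^ w.re)) := by gcongr
    _ = _ := by ring

/-- In Lipschitz's formula the zero frequency gives the singular term. The frequencies ±2πi(n+1) are
expanded in powers of t; summing over n first produces ζ(w+r), which the functional equation turns
into ζ(1-w-r). -/
lemma polyLog_expansion_of_re_neg {w : ℂ} (hw : 1 < w.re) {t : ℝ} (ht : 0 < t) (ht' : t ≤ 1) :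
    polyLog (1 - w) t = Gamma w * (t : ℂ) ^ (-w) + ∑' n, zetaCoeff n (1 - w) * (t : ℂ) ^ n := by
  set z : ℕ → ℂ := fun n => ((2 * Real.pi * (n + 1) : ℝ) : ℂ) * I with hz
  have hznorm : ∀ n, ‖(t : ℂ)‖ < ‖z n‖ := fun n => by
    have hπ := Real.pi_gt_three
    have h0 : (0 : ℝ) ≤ n := n.cast_nonneg
    simp only [hz, norm_mul, norm_I, mul_one]
    rw [norm_real, norm_real, Real.norm_of_nonneg ht.le, Real.norm_of_nonneg (by positivity)]
    nlinarith
  have hzre : ∀ n, (z n).re = 0 := fun n => by simp [hz]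
  set f : ℤ → ℂ := fun n => ((t : ℂ) + 2 * Real.pi * n * I) ^ (-w) with hf
  have hS : Summable f := summable_cpow_int t hw
  have hSn : Summable fun n : ℕ => f n := hS.comp_injective Nat.cast_injective
  have hSn1 : Summable fun n : ℕ => f ((n + 1 : ℕ) : ℤ) :=
    hS.comp_injective (i := fun n : ℕ => ((n + 1 : ℕ) : ℤ)) fun a b h => by simpa using h
  have hSn' : Summable fun n : ℕ => f (-((n : ℤ) + 1)) :=
    hS.comp_injective (i := fun n : ℕ => -((n : ℤ) + 1)) fun a b h => by simpa using h
  have e0 : f ((0 : ℕ) : ℤ) = (t : ℂ) ^ (-w) := by simp [hf]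
  have e1 : ∀ n : ℕ, f ((n + 1 : ℕ) : ℤ) = (t + z n) ^ (-w) := fun n => by
    simp only [hf, hz]; congr 1; push_cast; ring
  have e2 : ∀ n : ℕ, f (-((n : ℤ) + 1)) = (t + -z n) ^ (-w) := fun n => by
    simp only [hf, hz]; congr 1; push_cast; ring
  have hpair : ∀ n : ℕ, ((t : ℂ) + z n) ^ (-w) + (t + -z n) ^ (-w) =
      ∑' r : ℕ, frequencyTerm w t n r := by
    intro n
    have h1 := hasSum_add_cpow (w := w) (hzre n).ge (hznorm n)
    have h2 := hasSum_add_cpow (z := -z n) (w := w) (t := t) (by simp [hzre n])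
      (by rw [norm_neg]; exact hznorm n)
    rw [← (h1.add h2).tsum_eq]
    refine tsum_congr fun r => ?_
    rw [frequencyTerm, ← frequency_pair]
    ring
  have hsplit : ∑' n : ℤ, f n = (t : ℂ) ^ (-w) + ∑' n : ℕ, ∑' r : ℕ, frequencyTerm w t n r := by
    rw [tsum_of_nat_of_neg_add_one hSn hSn', hSn.tsum_eq_zero_add, e0, add_assoc,
      ← hSn1.tsum_add hSn']
    simp only [e1, e2, hpair]
  rw [polyLog_eq_tsum_int ht hw, hsplit, mul_add]
  congr 1
  · clear hsplit hpair e0 e1 e2 hSn hSn1 hSn' hS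
    rw [← (summable_frequency hw ht ht').tsum_comm, ← tsum_mul_left]
    · refine tsum_congr fun r => ?_
      simp only [frequencyTerm]
      rw [tsum_mul_left, tsum_mul_left, ← zeta_eq_tsum_one_div_nat_add_one_cpow, zetaCoeff,
        show 1 - w - r = 1 - (w + r) by ring, riemannZeta_one_sub]
      · have h := Gamma_mul_choose (show 0 < w.re by linarith) r
        linear_combination ((t : ℂ) ^ r * ((2 * Real.pi) ^ (-(w + r)) *
          (2 * cos (Real.pi * (w + r) / 2)) * riemannZeta (w + r))) * h
      · intro m h
        have := congrArg re h
        simp only [add_re, natCast_re, neg_re] at this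
        have h0 : (0 : ℝ) ≤ r := r.cast_nonneg
        have h1 : (0 : ℝ) ≤ m := m.cast_nonneg
        linarith
      · intro h
        have := congrArg re h
        simp only [add_re, natCast_re, one_re] at this
        have h0 : (0 : ℝ) ≤ r := r.cast_nonneg
        linarith
      · simp only [add_re, natCast_re]
        have h0 : (0 : ℝ) ≤ r := r.cast_nonneg
        linarith

lemma norm_polyLog_term (k : ℕ+) (s : ℂ) (t : ℝ) :
    ‖((k : ℕ) : ℂ) ^ (-s) * exp (-(k * t))‖ = ((k : ℕ) : ℝ) ^ (-s.re) * Real.exp (-(k * t)) := by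
  rw [norm_mul, norm_natCast_cpow_of_pos k.pos, norm_exp]
  simp

lemma summable_pow_mul_exp_neg (M : ℕ) {t : ℝ} (ht : 0 < t) :
    Summable fun k : ℕ+ => ((k : ℕ) : ℝ) ^ M * Real.exp (-(k * t)) := by
  have h := (Real.summable_pow_mul_exp_neg_nat_mul M ht).comp_injective PNat.coe_injective
  refine h.congr fun k => ?_
  simp only [Function.comp]
  congr 2; ring

lemma rpow_neg_re_le {s : ℂ} {M : ℕ} (h : ‖s‖ ≤ M) (k : ℕ+) :
    ((k : ℕ) : ℝ) ^ (-s.re) ≤ ((k : ℕ) : ℝ) ^ M := by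
  rw [← Real.rpow_natCast]
  apply Real.rpow_le_rpow_of_exponent_le (by exact_mod_cast (one_le : 1 ≤ k))
  have := (abs_le.mp ((abs_re_le_norm s).trans h)).1
  linarith

lemma summable_polyLog (s : ℂ) {t : ℝ} (ht : 0 < t) :
    Summable fun k : ℕ+ => ((k : ℕ) : ℂ) ^ (-s) * exp (-(k * t)) := by
  obtain ⟨M, hM⟩ := exists_nat_ge ‖s‖
  refine Summable.of_norm_bounded (summable_pow_mul_exp_neg M ht) fun k => ?_
  rw [norm_polyLog_term]
  gcongr
  exact rpow_neg_re_le hM k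

lemma differentiable_polyLog {t : ℝ} (ht : 0 < t) : Differentiable ℂ fun s => polyLog s t := by
  intro s
  obtain ⟨M, hM⟩ := exists_nat_gt ‖s‖
  have hU : IsOpen {z : ℂ | ‖z‖ < M} := isOpen_lt continuous_norm continuous_const
  refine (differentiableOn_tsum_of_summable_norm (summable_pow_mul_exp_neg M ht) (fun k => ?_) hU
    fun k z hz => ?_).differentiableAt (hU.mem_nhds hM)
  · intro z _
    have : ((k : ℕ) : ℂ) ≠ 0 := by exact_mod_cast k.ne_zero
    exact ((differentiableAt_id.neg.const_cpow (Or.inl this)).mul_const _).differentiableWithinAt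
  · rw [norm_polyLog_term]
    gcongr
    exact rpow_neg_re_le (le_of_lt hz) k

lemma summable_zetaCoeff {s : ℂ} (hs : s.re < 1) : Summable fun n => ‖zetaCoeff n s‖ := by
  obtain ⟨C, _, hC⟩ := exists_zetaCoeff_bound (isCompact_singleton (x := s)) (by simpa using hs)
  exact Summable.of_nonneg_of_le (fun n => norm_nonneg _) (fun n => hC n s rfl)
    (summable_geometric_two.mul_left C)

lemma norm_zetaCoeff_mul_pow_le {t : ℝ} (ht : 0 < t) (ht' : t ≤ 1) (n : ℕ) (s : ℂ) :
    ‖zetaCoeff n s * (t : ℂ) ^ n‖ ≤ ‖zetaCoeff n s‖ := by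
  rw [norm_mul, norm_pow, norm_real, Real.norm_of_nonneg ht.le]
  exact mul_le_of_le_one_right (norm_nonneg _) (pow_le_one₀ ht.le ht')

/-- A series of functions, bounded geometrically on compact sets, is holomorphic. -/
lemma differentiableOn_tsum_of_compact_bound {ι : Type*} {F : ι → ℂ → ℂ} {U : Set ℂ}
    (hU : IsOpen U) (hd : ∀ n, DifferentiableOn ℂ (F n) U)
    (hb : ∀ K ⊆ U, IsCompact K → ∃ u : ι → ℝ, Summable u ∧ ∀ n, ∀ s ∈ K, ‖F n s‖ ≤ u n) :
    DifferentiableOn ℂ (fun s => ∑' n, F n s) U := by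
  intro s hs
  obtain ⟨K, hKn, hKU, hK⟩ := local_compact_nhds (hU.mem_nhds hs)
  obtain ⟨u, hu, hub⟩ := hb K hKU hK
  exact ((differentiableOn_tsum_of_summable_norm hu
    (fun n => (hd n).mono (interior_subset.trans hKU)) isOpen_interior
    fun n z hz => hub n z (interior_subset hz)).differentiableAt
      (isOpen_interior.mem_nhds (mem_interior_iff_mem_nhds.mpr hKn))).differentiableWithinAt

/-- For fixed t both sides are holomorphic in s on Re s < 1 and agree on Re s < 0. -/
theorem polyLog_expansion {s : ℂ} (hs : s.re < 1) {t : ℝ} (ht : 0 < t) (ht' : t ≤ 1) :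
    polyLog s t = Gamma (1 - s) * (t : ℂ) ^ (s - 1) + ∑' n, zetaCoeff n s * (t : ℂ) ^ n := by
  have hU : IsOpen {s : ℂ | s.re < 1} := isOpen_lt continuous_re continuous_const
  have ht0 : (t : ℂ) ≠ 0 := by exact_mod_cast ht.ne'
  have hR : DifferentiableOn ℂ (fun s => Gamma (1 - s) * (t : ℂ) ^ (s - 1) +
      ∑' n, zetaCoeff n s * (t : ℂ) ^ n) {s : ℂ | s.re < 1} := by
    refine DifferentiableOn.add (fun s hs => ?_) (differentiableOn_tsum_of_compact_bound hU
      (fun n => (differentiableOn_zetaCoeff n).mul_const _) fun K hKU hK => ?_)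
    · have hG : DifferentiableAt ℂ Gamma (1 - s) := by
        refine differentiableAt_Gamma _ fun m h => ?_
        have := congrArg re h
        simp only [sub_re, one_re, neg_re, natCast_re] at this
        have hs : s.re < 1 := hs
        have h1 : (0 : ℝ) ≤ m := m.cast_nonneg
        linarith
      have hG' : DifferentiableAt ℂ (fun s => Gamma (1 - s)) s :=
        hG.comp (f := fun s : ℂ => 1 - s) s (by fun_prop)
      have h2 : DifferentiableAt ℂ (fun s : ℂ => (t : ℂ) ^ (s - 1)) s :=
        (differentiableAt_id.sub_const 1).const_cpow (Or.inl ht0)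
      exact (hG'.mul h2).differentiableWithinAt
    · obtain ⟨C, _, hC⟩ := exists_zetaCoeff_bound hK hKU
      exact ⟨_, summable_geometric_two.mul_left C,
        fun n s hs => (norm_zetaCoeff_mul_pow_le ht ht' n s).trans (hC n s hs)⟩
  refine AnalyticOnNhd.eqOn_of_preconnected_of_eventuallyEq (z₀ := -1)
    ((differentiable_polyLog ht).differentiableOn.analyticOnNhd hU) (hR.analyticOnNhd hU)
    (convex_halfSpace_re_lt 1).isPreconnected (by simp) ?_ hs
  have hV : IsOpen {s : ℂ | s.re < 0} := isOpen_lt continuous_re continuous_const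
  filter_upwards [hV.mem_nhds (show ((-1 : ℂ)).re < 0 by simp)] with s hs
  have hs : s.re < 0 := hs
  have := polyLog_expansion_of_re_neg (w := 1 - s) (by simp; linarith) ht ht'
  simpa using this

end PolyLogExpansion

end WittenZeta

namespace WittenZeta

/-! ### Mellin representation of Γ(s) ω(s) and its splitting at 1. -/

section MellinRepresentation

open Complex Set MeasureTheory

/-- `∑ zetaCoeff` convolved with itself: the coefficients of the square of the regular part. -/
noncomputable def convCoeff (n : ℕ) (s : ℂ) : ℂ :=
  ∑ k ∈ Finset.range (n + 1), zetaCoeff k s * zetaCoeff (n - k) s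

lemma differentiableOn_convCoeff (n : ℕ) : DifferentiableOn ℂ (convCoeff n) {s | s.re < 1} :=
  DifferentiableOn.fun_sum fun k _ =>
    (differentiableOn_zetaCoeff k).mul (differentiableOn_zetaCoeff (n - k))

lemma exists_convCoeff_bound {K : Set ℂ} (hK : IsCompact K) (hK' : K ⊆ {s | s.re < 1}) :
    ∃ C : ℝ, 0 ≤ C ∧ ∀ n, ∀ s ∈ K, ‖convCoeff n s‖ ≤ C * ((n + 1) * (1 / 2) ^ n) := by
  obtain ⟨C, hC0, hC⟩ := exists_zetaCoeff_bound hK hK'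
  refine ⟨C * C, by positivity, fun n s hs => ?_⟩
  refine (norm_sum_le _ _).trans ?_
  calc ∑ k ∈ Finset.range (n + 1), ‖zetaCoeff k s * zetaCoeff (n - k) s‖
      ≤ ∑ k ∈ Finset.range (n + 1), C * C * (1 / 2) ^ n := by
        refine Finset.sum_le_sum fun k hk => ?_
        have hk : k ≤ n := by simpa [Nat.lt_succ_iff] using hk
        rw [norm_mul]
        calc ‖zetaCoeff k s‖ * ‖zetaCoeff (n - k) s‖
            ≤ (C * (1 / 2) ^ k) * (C * (1 / 2) ^ (n - k)) := by
              gcongr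
              · exact hC k s hs
              · exact hC _ s hs
          _ = C * C * (1 / 2) ^ n := by
              rw [mul_mul_mul_comm, ← pow_add, Nat.add_sub_cancel' hk]
    _ = _ := by rw [Finset.sum_const, Finset.card_range, nsmul_eq_mul]; push_cast; ring

lemma summable_succ_mul_geometric_half : Summable fun n : ℕ => ((n : ℝ) + 1) * (1 / 2) ^ n := by
  have h := (summable_pow_mul_geometric_of_norm_lt_one 1 (r := (1 / 2 : ℝ)) (by norm_num)).add
    summable_geometric_two
  refine h.congr fun n => ?_
  ring

lemma summable_convCoeff {s : ℂ} (hs : s.re < 1) : Summable fun n => ‖convCoeff n s‖ := by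
  obtain ⟨C, _, hC⟩ := exists_convCoeff_bound (isCompact_singleton (x := s)) (by simpa using hs)
  exact Summable.of_nonneg_of_le (fun n => norm_nonneg _) (fun n => hC n s rfl)
    (summable_succ_mul_geometric_half.mul_left C)

lemma sq_tsum_zetaCoeff {s : ℂ} (hs : s.re < 1) {t : ℝ} (ht : 0 < t) (ht' : t ≤ 1) :
    (∑' n, zetaCoeff n s * (t : ℂ) ^ n) ^ 2 = ∑' n, convCoeff n s * (t : ℂ) ^ n := by
  have h : Summable fun n => ‖zetaCoeff n s * (t : ℂ) ^ n‖ :=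
    Summable.of_nonneg_of_le (fun n => norm_nonneg _)
      (fun n => norm_zetaCoeff_mul_pow_le ht ht' n s) (summable_zetaCoeff hs)
  rw [sq, tsum_mul_tsum_eq_tsum_sum_range_of_summable_norm h h]
  refine tsum_congr fun n => ?_
  rw [convCoeff, Finset.sum_mul]
  refine Finset.sum_congr rfl fun k hk => ?_
  have hk : k ≤ n := by simpa [Nat.lt_succ_iff] using hk
  rw [mul_mul_mul_comm, ← pow_add, Nat.add_sub_cancel' hk]

lemma integrableOn_Ioc_cpow {z : ℂ} (hz : 0 < z.re) :
    IntegrableOn (fun x : ℝ => (x : ℂ) ^ (z - 1)) (Ioc 0 1) := by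
  rw [← intervalIntegrable_iff_integrableOn_Ioc_of_le zero_le_one]
  exact intervalIntegral.intervalIntegrable_cpow' (by simp; linarith)

lemma integral_Ioc_cpow {z : ℂ} (hz : 0 < z.re) :
    ∫ x in Ioc (0 : ℝ) 1, (x : ℂ) ^ (z - 1) = 1 / z := by
  have hz0 : z ≠ 0 := by rintro rfl; simp at hz
  rw [← intervalIntegral.integral_of_le zero_le_one, integral_cpow (Or.inl (by simp; linarith)),
    sub_add_cancel, ofReal_zero, ofReal_one, one_cpow, zero_cpow hz0, sub_zero]

/-- Termwise Mellin transform over `(0, 1]` of an absolutely convergent power series. -/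
lemma mellin_Ioc_powerSeries {b : ℕ → ℂ} (hb : Summable fun n => ‖b n‖) {z : ℂ} (hz : 0 < z.re) :
    IntegrableOn (fun x : ℝ => (x : ℂ) ^ (z - 1) * ∑' n, b n * (x : ℂ) ^ n) (Ioc 0 1) ∧
      ∫ x in Ioc (0 : ℝ) 1, (x : ℂ) ^ (z - 1) * ∑' n, b n * (x : ℂ) ^ n = ∑' n, b n / (z + n) := by
  have hle : ∀ (n : ℕ), ∀ x ∈ Ioc (0 : ℝ) 1, ‖b n * (x : ℂ) ^ n‖ ≤ ‖b n‖ := fun n x hx => by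
    rw [norm_mul, norm_pow, norm_real, Real.norm_of_nonneg hx.1.le]
    exact mul_le_of_le_one_right (norm_nonneg _) (pow_le_one₀ hx.1.le hx.2)
  have hcont : ContinuousOn (fun x : ℝ => ∑' n, b n * (x : ℂ) ^ n) (Ioc 0 1) :=
    continuousOn_tsum (fun n => by fun_prop) hb hle
  have hbound : ∀ x ∈ Ioc (0 : ℝ) 1, ‖∑' n, b n * (x : ℂ) ^ n‖ ≤ ∑' n, ‖b n‖ := fun x hx =>
    tsum_of_norm_bounded hb.hasSum fun n => hle n x hx
  have hint := integrableOn_Ioc_cpow hz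
  have hzn : ∀ n : ℕ, 0 < (z + n).re := fun n => by
    simp only [add_re, natCast_re]; positivity
  have hterm : ∀ n : ℕ, ∀ x ∈ Ioc (0 : ℝ) 1,
      b n * (x : ℂ) ^ (z + n - 1) = (x : ℂ) ^ (z - 1) * (b n * (x : ℂ) ^ n) := fun n x hx => by
    have hx0 : (x : ℂ) ≠ 0 := by exact_mod_cast hx.1.ne'
    rw [show z + n - 1 = (z - 1) + n by ring, cpow_add _ _ hx0, cpow_natCast]; ring
  constructor
  · exact hint.mul_bdd (c := ∑' n, ‖b n‖) (hcont.aestronglyMeasurable measurableSet_Ioc)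
      ((ae_restrict_iff' measurableSet_Ioc).mpr (Eventually.of_forall hbound))
  · have h := hasSum_integral_of_summable_integral_norm
      (μ := volume.restrict (Ioc (0 : ℝ) 1)) (F := fun (n : ℕ) (x : ℝ) => b n * (x : ℂ) ^ (z + n - 1))
      (fun n => (integrableOn_Ioc_cpow (hzn n)).const_mul _) ?_
    · rw [setIntegral_congr_fun (g := fun x : ℝ => ∑' n, b n * (x : ℂ) ^ (z + n - 1))
        measurableSet_Ioc fun x hx => ?_, ← h.tsum_eq]
      · refine tsum_congr fun n => ?_
        rw [integral_const_mul, integral_Ioc_cpow (hzn n), mul_one_div]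
      · simp only
        rw [← tsum_mul_left]
        exact tsum_congr fun n => (hterm n x hx).symm
    · refine Summable.of_nonneg_of_le (fun n => by positivity) (fun n => ?_)
        (hb.mul_right (∫ x in Ioc (0 : ℝ) 1, ‖(x : ℂ) ^ (z - 1)‖))
      rw [← integral_const_mul]
      refine setIntegral_mono_on ((integrableOn_Ioc_cpow (hzn n)).const_mul _).norm
        (hint.norm.const_mul _) measurableSet_Ioc fun x hx => ?_
      rw [hterm n x hx, norm_mul, mul_comm]
      gcongr
      exact hle n x hx

/-- The upper incomplete Mellin integral `∫_1^∞ x^(s-1) e^{-a x} dx`. -/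
noncomputable def upperMellin (a : ℕ) (s : ℂ) : ℂ :=
  ∫ x in Ioi (1 : ℝ), (x : ℂ) ^ (s - 1) * exp (-(a * x))

lemma differentiable_upperMellin {a : ℕ} (ha : 0 < a) : Differentiable ℂ (upperMellin a) := by
  have hm : upperMellin a =
      mellin (indicator (Ioi (1 : ℝ)) fun x : ℝ => exp (-(a * x))) := by
    ext s
    rw [upperMellin, mellin]
    simp_rw [← indicator_smul]
    rw [setIntegral_indicator measurableSet_Ioi, inter_eq_right.mpr (Ioi_subset_Ioi zero_le_one)]
    rfl
  rw [hm]
  intro s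
  have hloc : LocallyIntegrable (indicator (Ioi (1 : ℝ)) fun x : ℝ => exp (-(a * x))) :=
    (Continuous.locallyIntegrable (by fun_prop)).indicator measurableSet_Ioi
  -- The truncated function vanishes near 0, so any exponent b < Re s is admissible and the
  -- transform is entire.
  refine mellin_differentiableAt_of_isBigO_rpow_exp (a := a) (b := s.re - 1) (by exact_mod_cast ha)
    (hloc.locallyIntegrableOn _) ?_ ?_ (by linarith)
  · refine Asymptotics.IsBigO.of_bound 1 (Eventually.of_forall fun x => ?_)
    refine (norm_indicator_le_norm_self _ _).trans ?_
    rw [norm_exp, one_mul, Real.norm_of_nonneg (Real.exp_pos _).le]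
    simp
  · refine Asymptotics.IsBigO.of_bound 0 ?_
    filter_upwards [nhdsWithin_le_nhds (Iio_mem_nhds one_pos)] with x hx
    rw [indicator_of_notMem (by simpa using (mem_Iio.mp hx).le)]
    simp

/-- For a, x ≥ 1, (a-1)(x-1) ≥ 0 gives e^{-ax} ≤ e · e^{-a} e^{-x}. The decay in a makes the tail
terms summable. -/
lemma norm_upperMellin_le {a M : ℕ} (ha : 0 < a) {s : ℂ} (hs : ‖s‖ ≤ M) :
    ‖upperMellin a s‖ ≤
      Real.exp 1 * (∫ x in Ioi (0 : ℝ), x ^ (M : ℝ) * Real.exp (-1 * x)) * Real.exp (-a) := by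
  have hint := integrableOn_rpow_mul_exp_neg_mul (p := M) (b := 1)
    (by have : (0 : ℝ) ≤ M := M.cast_nonneg
        linarith) one_pos
  have hre := (abs_le.mp ((abs_re_le_norm s).trans hs)).2
  have ha1 : (1 : ℝ) ≤ a := by exact_mod_cast ha
  refine (norm_integral_le_of_norm_le
    (g := fun x => Real.exp 1 * Real.exp (-a) * (x ^ (M : ℝ) * Real.exp (-1 * x)))
    ((hint.mono_set (Ioi_subset_Ioi zero_le_one)).const_mul _) ?_).trans ?_
  · filter_upwards [ae_restrict_mem measurableSet_Ioi] with x hx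
    have hx : 1 < x := hx
    have := norm_cpow_mul_exp_neg_mul (a := s) (r := a) (zero_lt_one.trans hx)
    rw [this, natCast_re, mul_left_comm, ← Real.exp_add, ← Real.exp_add]
    gcongr
    · exact hx.le
    · linarith
    · nlinarith
  · rw [integral_const_mul]
    have : ∫ x in Ioi (1 : ℝ), x ^ (M : ℝ) * Real.exp (-1 * x) ≤
        ∫ x in Ioi (0 : ℝ), x ^ (M : ℝ) * Real.exp (-1 * x) := by
      refine setIntegral_mono_set hint ?_ (Ioi_subset_Ioi zero_le_one).eventuallyLE
      filter_upwards [ae_restrict_mem measurableSet_Ioi] with x hx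
      have : 0 < x := hx
      positivity
    calc _ ≤ Real.exp 1 * Real.exp (-a) *
          ∫ x in Ioi (0 : ℝ), x ^ (M : ℝ) * Real.exp (-1 * x) := by gcongr
      _ = _ := by ring

/-- The part of the Mellin integral of the `p`-th term lying over `(1, ∞)`. -/
noncomputable def tailTerm (s : ℂ) (p : ℕ+ × ℕ+) : ℂ :=
  ((p.1 : ℕ) : ℂ) ^ (-s) * ((p.2 : ℕ) : ℂ) ^ (-s) * upperMellin (p.1 + p.2 : ℕ) s

lemma tailTerm_bound {M : ℕ} : ∃ u : ℕ+ × ℕ+ → ℝ, Summable u ∧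
    ∀ p, ∀ s : ℂ, ‖s‖ ≤ M → ‖tailTerm s p‖ ≤ u p := by
  have h := summable_pow_mul_exp_neg M one_pos
  have hnn : ∀ k : ℕ+, 0 ≤ ((k : ℕ) : ℝ) ^ M * Real.exp (-(k * 1)) := fun k => by positivity
  have h2 := h.mul_of_nonneg h hnn hnn
  set J := ∫ x in Ioi (0 : ℝ), x ^ (M : ℝ) * Real.exp (-1 * x)
  refine ⟨_, h2.mul_left (Real.exp 1 * J), fun p s hs => ?_⟩
  rw [tailTerm, norm_mul, norm_mul, norm_natCast_cpow_of_pos p.1.pos,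
    norm_natCast_cpow_of_pos p.2.pos, neg_re]
  have h3 := norm_upperMellin_le (a := (p.1 + p.2 : ℕ)) (by have := p.1.pos; omega) hs
  calc _ ≤ ((p.1 : ℕ) : ℝ) ^ M * ((p.2 : ℕ) : ℝ) ^ M *
        (Real.exp 1 * J * Real.exp (-((p.1 + p.2 : ℕ) : ℝ))) := by
        gcongr
        · exact rpow_neg_re_le hs p.1
        · exact rpow_neg_re_le hs p.2
    _ = _ := by
      push_cast
      rw [neg_add, Real.exp_add, mul_one, mul_one]
      ring

lemma summable_tailTerm (s : ℂ) : Summable (tailTerm s) := by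
  obtain ⟨M, hM⟩ := exists_nat_ge ‖s‖
  obtain ⟨u, hu, h⟩ := tailTerm_bound (M := M)
  exact Summable.of_norm_bounded hu fun p => h p s hM

lemma differentiable_tsum_tailTerm : Differentiable ℂ fun s => ∑' p, tailTerm s p := by
  rw [← differentiableOn_univ]
  refine differentiableOn_tsum_of_compact_bound isOpen_univ (fun p => ?_) fun K _ hK => ?_
  · have h1 : ((p.1 : ℕ) : ℂ) ≠ 0 := by exact_mod_cast p.1.ne_zero
    have h2 : ((p.2 : ℕ) : ℂ) ≠ 0 := by exact_mod_cast p.2.ne_zero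
    have h3 := differentiable_upperMellin (a := (p.1 + p.2 : ℕ)) (by have := p.1.pos; omega)
    refine Differentiable.differentiableOn fun s => ?_
    exact ((differentiableAt_id.neg.const_cpow (Or.inl h1)).mul
      (differentiableAt_id.neg.const_cpow (Or.inl h2))).mul h3.differentiableAt
  · obtain ⟨R, hR⟩ := hK.exists_bound_of_continuousOn (f := id) continuousOn_id
    obtain ⟨M, hM⟩ := exists_nat_ge R
    obtain ⟨u, hu, h⟩ := tailTerm_bound (M := M)
    exact ⟨u, hu, fun p s hs => h p s ((hR s hs).trans hM)⟩

lemma norm_wittenTerm (s : ℂ) (p : ℕ+ × ℕ+) :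
    ‖wittenTerm s p‖ = (((p.1 * p.2 * (p.1 + p.2) : ℕ+) : ℕ) : ℝ) ^ (-s.re) := by
  rw [wittenTerm, norm_div, norm_one, norm_natCast_cpow_of_pos (PNat.pos _), Real.rpow_neg
    (by positivity), one_div]

/-- From x + y ≥ √(xy) follows xy(x+y) ≥ (xy)^(3/2), so the series is dominated by the square of the
sum of k^(-3σ/2). -/
lemma summable_witten_rpow {σ : ℝ} (hσ : 2 / 3 < σ) :
    Summable fun p : ℕ+ × ℕ+ => (((p.1 * p.2 * (p.1 + p.2) : ℕ+) : ℕ) : ℝ) ^ (-σ) := by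
  have h1 : Summable fun k : ℕ+ => ((k : ℕ) : ℝ) ^ (-(3 / 2 * σ)) := by
    have := (Real.summable_nat_rpow (p := -(3 / 2 * σ))).mpr (by linarith)
    exact this.comp_injective PNat.coe_injective
  have h2 := h1.mul_of_nonneg h1 (fun k => by positivity) (fun k => by positivity)
  refine Summable.of_nonneg_of_le (fun p => by positivity) (fun p => ?_) h2
  have hx : (0 : ℝ) < (p.1 : ℕ) := by exact_mod_cast p.1.pos
  have hy : (0 : ℝ) < (p.2 : ℕ) := by exact_mod_cast p.2.pos
  push_cast
  set x : ℝ := ((p.1 : ℕ) : ℝ)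
  set y : ℝ := ((p.2 : ℕ) : ℝ)
  have h3 : (x * y) ^ (3 / 2 : ℝ) ≤ x * y * (x + y) := by
    rw [show (3 / 2 : ℝ) = 1 + 1 / 2 by norm_num, Real.rpow_add (by positivity), Real.rpow_one,
      ← Real.sqrt_eq_rpow]
    gcongr
    rw [Real.sqrt_le_left (by positivity)]
    nlinarith [sq_nonneg (x - y)]
  rw [← Real.mul_rpow hx.le hy.le, show -(3 / 2 * σ) = 3 / 2 * -σ by ring,
    Real.rpow_mul (by positivity)]
  exact Real.rpow_le_rpow_of_nonpos (by positivity) h3 (by linarith)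

lemma summable_wittenTerm {s : ℂ} (hs : 2 / 3 < s.re) : Summable (wittenTerm s) :=
  Summable.of_norm_bounded (summable_witten_rpow hs) fun p => (norm_wittenTerm s p).le

lemma differentiableOn_tsum_wittenTerm :
    DifferentiableOn ℂ (fun s => ∑' p, wittenTerm s p) {s | 2 / 3 < s.re} := by
  intro s hs
  have hs : 2 / 3 < s.re := hs
  obtain ⟨σ, h1, h2⟩ := exists_between hs
  have hU : IsOpen {z : ℂ | σ < z.re} := isOpen_lt continuous_const continuous_re
  refine ((differentiableOn_tsum_of_summable_norm (summable_witten_rpow h1) (fun p => ?_) hU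
    fun p z hz => ?_).differentiableAt (hU.mem_nhds h2)).differentiableWithinAt
  · intro z _
    have h0 : (((p.1 * p.2 * (p.1 + p.2) : ℕ+) : ℕ) : ℂ) ≠ 0 := by exact_mod_cast PNat.ne_zero _
    refine DifferentiableAt.differentiableWithinAt ?_
    refine (differentiableAt_const _).div (differentiableAt_id.const_cpow (Or.inl h0)) ?_
    exact fun h => h0 ((cpow_eq_zero_iff _ _).mp h).1
  · rw [norm_wittenTerm]
    have : (1 : ℝ) ≤ (((p.1 * p.2 * (p.1 + p.2) : ℕ+) : ℕ) : ℝ) := by exact_mod_cast PNat.pos _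
    exact Real.rpow_le_rpow_of_exponent_le this (by linarith [show σ < z.re from hz])

/-- The Mellin integrand of the `p`-th term. -/
noncomputable def mellinIntegrand (s : ℂ) (p : ℕ+ × ℕ+) (x : ℝ) : ℂ :=
  ((p.1 : ℕ) : ℂ) ^ (-s) * ((p.2 : ℕ) : ℂ) ^ (-s) *
    ((x : ℂ) ^ (s - 1) * exp (-((p.1 + p.2 : ℕ) * x)))

lemma integrableOn_mellinIntegrand {s : ℂ} (hs : 0 < s.re) (p : ℕ+ × ℕ+) :
    IntegrableOn (mellinIntegrand s p) (Ioi 0) := by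
  refine (integrableOn_cpow_mul_exp hs ?_).const_mul _
  rw [natCast_re]
  exact_mod_cast Nat.add_pos_left p.1.pos _

lemma wittenTerm_eq (s : ℂ) (p : ℕ+ × ℕ+) : wittenTerm s p =
    ((p.1 : ℕ) : ℂ) ^ (-s) * ((p.2 : ℕ) : ℂ) ^ (-s) * ((p.1 + p.2 : ℕ) : ℂ) ^ (-s) := by
  rw [wittenTerm, one_div, ← cpow_neg, PNat.mul_coe, PNat.mul_coe, PNat.add_coe, Nat.cast_mul,
    natCast_mul_natCast_cpow, Nat.cast_mul, natCast_mul_natCast_cpow]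

lemma integral_mellinIntegrand {s : ℂ} (hs : 0 < s.re) (p : ℕ+ × ℕ+) :
    ∫ x in Ioi (0 : ℝ), mellinIntegrand s p x = Gamma s * wittenTerm s p := by
  simp only [mellinIntegrand]
  rw [integral_const_mul, laplace_cpow hs, wittenTerm_eq]
  · ring
  · rw [natCast_re]
    exact_mod_cast Nat.add_pos_left p.1.pos _

/-- The norm of the integrand is the integrand at Re s. Hence the absolute convergence needed to
exchange sum and integral is convergence of the series at Re s. -/
lemma norm_mellinIntegrand (s : ℂ) (p : ℕ+ × ℕ+) {x : ℝ} (hx : 0 < x) :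
    (‖mellinIntegrand s p x‖ : ℂ) = mellinIntegrand s.re p x := by
  rw [mellinIntegrand, norm_mul, norm_mul, norm_natCast_cpow_of_pos p.1.pos,
    norm_natCast_cpow_of_pos p.2.pos, norm_cpow_mul_exp_neg_mul hx, mellinIntegrand]
  push_cast
  rw [ofReal_cpow (by positivity), ofReal_cpow (by positivity), ofReal_cpow hx.le]
  simp only [neg_re, add_re, natCast_re, ofReal_neg, ofReal_add, ofReal_sub, ofReal_one,
    ofReal_natCast, neg_mul]

lemma integral_norm_mellinIntegrand {s : ℂ} (hs : 0 < s.re) (p : ℕ+ × ℕ+) :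
    ∫ x in Ioi (0 : ℝ), ‖mellinIntegrand s p x‖ = ‖Gamma s.re * wittenTerm s.re p‖ := by
  have h : ((∫ x in Ioi (0 : ℝ), ‖mellinIntegrand s p x‖ : ℝ) : ℂ) =
      Gamma s.re * wittenTerm s.re p := by
    rw [← integral_mellinIntegrand (by simpa using hs)]
    refine (integral_ofReal (𝕜 := ℂ)).symm.trans ?_
    exact setIntegral_congr_fun measurableSet_Ioi fun x hx => norm_mellinIntegrand s p hx
  rw [← h, norm_real, Real.norm_of_nonneg (integral_nonneg fun x => norm_nonneg _)]

lemma tsum_mellinIntegrand (s : ℂ) {x : ℝ} (hx : 0 < x) :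
    ∑' p, mellinIntegrand s p x = (x : ℂ) ^ (s - 1) * polyLog s x ^ 2 := by
  have h := (summable_polyLog s hx).norm
  rw [polyLog, sq, tsum_mul_tsum_of_summable_norm h h, ← tsum_mul_left]
  refine tsum_congr fun p => ?_
  rw [mellinIntegrand]
  push_cast
  rw [add_mul, neg_add, exp_add]
  ring

/-- Splitting the Mellin integral of `ω` at `1`. -/
lemma Gamma_mul_tsum_wittenTerm {s : ℂ} (hs : 2 / 3 < s.re) :
    Gamma s * ∑' p, wittenTerm s p = ∑' p, tailTerm s p +
      ∫ x in Ioc (0 : ℝ) 1, (x : ℂ) ^ (s - 1) * polyLog s x ^ 2 := by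
  have hs0 : 0 < s.re := by linarith
  have hI := integrableOn_mellinIntegrand hs0
  have hsum := hasSum_integral_of_summable_integral_norm (μ := volume.restrict (Ioc (0 : ℝ) 1))
    (F := mellinIntegrand s) (fun p => (hI p).mono_set Ioc_subset_Ioi_self) ?_
  · rw [setIntegral_congr_fun measurableSet_Ioc
      (g := fun x : ℝ => (x : ℂ) ^ (s - 1) * polyLog s x ^ 2)
      fun x hx => tsum_mellinIntegrand s hx.1] at hsum
    rw [← hsum.tsum_eq, ← (summable_tailTerm s).tsum_add hsum.summable, ← tsum_mul_left]
    refine tsum_congr fun p => ?_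
    rw [← integral_mellinIntegrand hs0, ← Ioc_union_Ioi_eq_Ioi zero_le_one,
      setIntegral_union (Ioc_disjoint_Ioi le_rfl) measurableSet_Ioi
        ((hI p).mono_set Ioc_subset_Ioi_self) ((hI p).mono_set (Ioi_subset_Ioi zero_le_one)), add_comm]
    congr 1
    simp only [mellinIntegrand]
    rw [integral_const_mul, tailTerm, upperMellin]
  · have h := ((summable_wittenTerm (s := s.re) (by simpa using hs)).mul_left (Gamma s.re)).norm
    refine Summable.of_nonneg_of_le (fun p => by positivity) (fun p => ?_) h
    rw [← integral_norm_mellinIntegrand hs0]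
    exact setIntegral_mono_set (hI p).norm (Eventually.of_forall fun x => norm_nonneg _)
      Ioc_subset_Ioi_self.eventuallyLE

/-- The continuation of `Γ(s) ω(s)` to the half plane `Re s < 1`, with its poles displayed. -/
noncomputable def gammaWitten (s : ℂ) : ℂ :=
  ∑' p, tailTerm s p + Gamma (1 - s) ^ 2 / 3 / (s - 2 / 3) +
    ∑' n : ℕ, Gamma (1 - s) * zetaCoeff n s / (s - (1 - n) / 2) +
    ∑' n : ℕ, convCoeff n s / (s - -n)

/-- In the strip 2/3 < Re s < 1 the integral representation and the expansion are both valid. The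
three parts of the square integrate to multiples of 1/(3s-2), 1/(2s-1+n) and 1/(s+n). -/
theorem Gamma_mul_tsum_wittenTerm_eq_gammaWitten {s : ℂ} (hs : 2 / 3 < s.re) (hs' : s.re < 1) :
    Gamma s * ∑' p, wittenTerm s p = gammaWitten s := by
  rw [Gamma_mul_tsum_wittenTerm hs, gammaWitten, add_assoc, add_assoc]
  congr 1
  have h1 : 0 < (3 * s - 2).re := by simp; linarith
  have h2 : 0 < (2 * s - 1).re := by simp; linarith
  have h3 : 0 < s.re := by linarith
  have i1 := integrableOn_Ioc_cpow h1
  obtain ⟨i2, e2⟩ := mellin_Ioc_powerSeries (summable_zetaCoeff hs') h2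
  obtain ⟨i3, e3⟩ := mellin_Ioc_powerSeries (summable_convCoeff hs') h3
  have hcongr : ∀ x ∈ Ioc (0 : ℝ) 1, (x : ℂ) ^ (s - 1) * polyLog s x ^ 2 =
      Gamma (1 - s) ^ 2 * (x : ℂ) ^ (3 * s - 2 - 1) +
        (2 * Gamma (1 - s) * ((x : ℂ) ^ (2 * s - 1 - 1) * ∑' n, zetaCoeff n s * (x : ℂ) ^ n) +
        (x : ℂ) ^ (s - 1) * ∑' n, convCoeff n s * (x : ℂ) ^ n) := by
    intro x hx
    have hx0 : (x : ℂ) ≠ 0 := by exact_mod_cast hx.1.ne'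
    rw [← sq_tsum_zetaCoeff hs' hx.1 hx.2, polyLog_expansion hs' hx.1 hx.2,
      show 3 * s - 2 - 1 = (s - 1) + (s - 1) + (s - 1) by ring,
      show 2 * s - 1 - 1 = (s - 1) + (s - 1) by ring]
    simp only [cpow_add _ _ hx0]
    ring
  have j1 : IntegrableOn (fun x : ℝ => Gamma (1 - s) ^ 2 * (x : ℂ) ^ (3 * s - 2 - 1)) (Ioc 0 1) :=
    i1.const_mul _
  have j2 : IntegrableOn (fun x : ℝ => 2 * Gamma (1 - s) *
      ((x : ℂ) ^ (2 * s - 1 - 1) * ∑' n, zetaCoeff n s * (x : ℂ) ^ n)) (Ioc 0 1) := i2.const_mul _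
  have j3 : IntegrableOn (fun x : ℝ => 2 * Gamma (1 - s) *
      ((x : ℂ) ^ (2 * s - 1 - 1) * ∑' n, zetaCoeff n s * (x : ℂ) ^ n) +
        (x : ℂ) ^ (s - 1) * ∑' n, convCoeff n s * (x : ℂ) ^ n) (Ioc 0 1) := j2.add i3
  rw [setIntegral_congr_fun measurableSet_Ioc hcongr, integral_add j1 j3,
    integral_add j2 i3, integral_const_mul, integral_const_mul, integral_Ioc_cpow h1, e2, e3]
  congr 1
  · have : 3 * s - 2 = 3 * (s - 2 / 3) := by ring
    rw [this, mul_one_div, div_div]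
  · congr 1
    · rw [← tsum_mul_left]
      refine tsum_congr fun n => ?_
      rw [show 2 * s - 1 + n = 2 * (s - (1 - n) / 2) by ring, mul_div_assoc', mul_assoc,
        mul_div_mul_left _ _ two_ne_zero]
    · simp only [sub_neg_eq_add]

end MellinRepresentation

end WittenZeta

namespace WittenZeta

/-! ### Polar parts of series of simple fractions. -/

section PolarParts

open Complex Set

/-- Near `z`, off `z` itself, `f` is an analytic function plus `c / (s - z)`. -/
def HasPolarPart (f : ℂ → ℂ) (z c : ℂ) : Prop :=
  ∃ g : ℂ → ℂ, AnalyticAt ℂ g z ∧ f =ᶠ[𝓝[≠] z] fun s => g s + c / (s - z)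

lemma HasPolarPart.congr {f g : ℂ → ℂ} {z c : ℂ} (hf : HasPolarPart f z c) (h : g =ᶠ[𝓝[≠] z] f) :
    HasPolarPart g z c := by
  obtain ⟨u, hu, he⟩ := hf
  exact ⟨u, hu, h.trans he⟩

lemma HasPolarPart.add {f g : ℂ → ℂ} {z c d : ℂ} (hf : HasPolarPart f z c)
    (hg : HasPolarPart g z d) : HasPolarPart (fun s => f s + g s) z (c + d) := by
  obtain ⟨u, hu, he⟩ := hf
  obtain ⟨v, hv, he'⟩ := hg
  refine ⟨fun s => u s + v s, hu.add hv, ?_⟩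
  filter_upwards [he, he'] with s h1 h2
  rw [h1, h2]; ring

lemma hasPolarPart_of_analyticAt {f : ℂ → ℂ} {z : ℂ} (hf : AnalyticAt ℂ f z) :
    HasPolarPart f z 0 :=
  ⟨f, hf, by simp⟩

/-- When p = z, the quotient (h(s) - h(p))/(s - p) extends analytically as `dslope`, leaving h(p)/(s
- p). -/
lemma hasPolarPart_div_sub {h : ℂ → ℂ} {z : ℂ} (hh : AnalyticAt ℂ h z) (p : ℂ) :
    HasPolarPart (fun s => h s / (s - p)) z (if p = z then h z else 0) := by
  split_ifs with hp
  · subst hp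
    obtain ⟨q, hq⟩ := hh
    refine ⟨dslope h p, ⟨_, hq.has_fpower_series_dslope_fslope⟩, ?_⟩
    filter_upwards [self_mem_nhdsWithin] with s hs
    have hs : s ≠ p := hs
    have : s - p ≠ 0 := sub_ne_zero.mpr hs
    rw [dslope_of_ne _ hs, slope_def_field]
    field_simp
    ring
  · refine hasPolarPart_of_analyticAt (hh.div (by fun_prop) ?_)
    exact sub_ne_zero.mpr (Ne.symm hp)

lemma HasPolarPart.meromorphicAt {f : ℂ → ℂ} {z c : ℂ} (hf : HasPolarPart f z c) :
    MeromorphicAt f z := by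
  obtain ⟨u, hu, he⟩ := hf
  refine MeromorphicAt.congr ?_ he.symm
  exact hu.meromorphicAt.add ((MeromorphicAt.const c z).div
    ((MeromorphicAt.id z).sub (MeromorphicAt.const z z)))

lemma HasPolarPart.tendsto {f : ℂ → ℂ} {z c : ℂ} (hf : HasPolarPart f z c) :
    Tendsto (fun s => (s - z) * f s) (𝓝[≠] z) (𝓝 c) := by
  obtain ⟨u, hu, he⟩ := hf
  have h : Tendsto (fun s => (s - z) * u s + c) (𝓝[≠] z) (𝓝 c) := by
    have hc : ContinuousAt (fun s => (s - z) * u s + c) z :=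
      ((continuousAt_id.sub continuousAt_const).mul hu.continuousAt).add continuousAt_const
    have := hc.tendsto
    simp only [sub_self, zero_mul, zero_add] at this
    exact this.mono_left nhdsWithin_le_nhds
  refine h.congr' ?_
  filter_upwards [he, self_mem_nhdsWithin] with s hs hne
  have : s - z ≠ 0 := sub_ne_zero.mpr hne
  rw [hs]
  field_simp

lemma HasPolarPart.hasSimplePole {f : ℂ → ℂ} {z c : ℂ} (hf : HasPolarPart f z c) (hc : c ≠ 0) :
    HasSimplePoleWithResidue f z c := by
  refine ⟨hf.meromorphicAt, ?_, hf.tendsto⟩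
  have hm := hf.meromorphicAt
  obtain ⟨u, hu, he⟩ := hf
  refine (meromorphicOrderAt_eq_int_iff (n := -1) hm).mpr
    ⟨fun s => (s - z) * u s + c, by fun_prop, by simpa using hc, ?_⟩
  filter_upwards [he, self_mem_nhdsWithin] with s hs hne
  have : s - z ≠ 0 := sub_ne_zero.mpr hne
  rw [hs, zpow_neg_one, smul_eq_mul]
  field_simp

lemma HasPolarPart.isRegularAt_iff {f : ℂ → ℂ} {z c : ℂ} (hf : HasPolarPart f z c) :
    IsRegularAt f z ↔ c = 0 := by
  constructor
  · rintro ⟨g, hg, he⟩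
    have h0 := ((hasPolarPart_of_analyticAt hg).congr he).tendsto
    exact tendsto_nhds_unique hf.tendsto h0
  · rintro rfl
    obtain ⟨u, hu, he⟩ := hf
    exact ⟨u, hu, by simpa using he⟩

/-- A series of simple fractions with poles tending to infinity has at `z` the polar part of the only
term that may have a pole there. -/
lemma hasPolarPart_tsum {F : ℕ → ℂ → ℂ} {p : ℕ → ℂ} {U : Set ℂ} (hU : IsOpen U)
    (hd : ∀ n, DifferentiableOn ℂ (F n) U)
    (hb : ∀ K ⊆ U, IsCompact K → ∃ u : ℕ → ℝ, Summable u ∧ ∀ n, ∀ s ∈ K, ‖F n s‖ ≤ u n)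
    (hp : Tendsto (fun n => ‖p n‖) atTop atTop) {z : ℂ} (hz : z ∈ U) (m : ℕ)
    (hm : ∀ n, n ≠ m → p n ≠ z) :
    HasPolarPart (fun s => ∑' n, F n s / (s - p n)) z (if p m = z then F m z else 0) := by
  -- The poles other than p m avoid z and tend to infinity, so their distances to z have a positive
  -- lower bound.
  obtain ⟨ε, hε, hεp⟩ : ∃ ε > 0, ∀ n, n ≠ m → ε ≤ ‖z - p n‖ := by
    have h1 : Tendsto (fun n => ‖z - p n‖⁻¹) atTop (𝓝 0) := by
      refine tendsto_inv_atTop_zero.comp (tendsto_atTop_mono (fun n => ?_)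
        (tendsto_atTop_add_const_right _ (-‖z‖) hp))
      have := norm_sub_norm_le (p n) z
      rw [norm_sub_rev] at this
      linarith
    obtain ⟨B, hB⟩ := h1.bddAbove_range
    refine ⟨1 / (|B| + 1), by positivity, fun n hn => ?_⟩
    have h2 : 0 < ‖z - p n‖ := norm_pos_iff.mpr (sub_ne_zero.mpr (hm n hn).symm)
    have h3 : ‖z - p n‖⁻¹ ≤ B := hB ⟨n, rfl⟩
    rw [one_div]
    refine inv_le_of_inv_le₀ h2 (h3.trans ?_)
    linarith [le_abs_self B]
  obtain ⟨K, hKn, hKU, hK⟩ := local_compact_nhds (hU.mem_nhds hz)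
  obtain ⟨u, hu, hub⟩ := hb K hKU hK
  set V := interior K ∩ Metric.ball z (ε / 2) with hV
  have hVo : IsOpen V := isOpen_interior.inter Metric.isOpen_ball
  have hzV : z ∈ V := ⟨mem_interior_iff_mem_nhds.mpr hKn, Metric.mem_ball_self (by linarith)⟩
  have hdist : ∀ s ∈ V, ∀ n, n ≠ m → ε / 2 ≤ ‖s - p n‖ := fun s hs n hn => by
    have h1 : ‖s - z‖ < ε / 2 := by simpa [dist_eq_norm] using hs.2
    have h2 := norm_sub_le_norm_sub_add_norm_sub z s (p n)
    have h3 := hεp n hn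
    rw [norm_sub_rev z s] at h2
    linarith
  set T : ℕ → ℂ → ℂ := fun n s => if n = m then 0 else F n s / (s - p n) with hT
  have hTb : ∀ n, ∀ s ∈ V, ‖T n s‖ ≤ u n * (2 / ε) := fun n s hs => by
    have h1 := hub n s (interior_subset hs.1)
    have hu0 : 0 ≤ u n := (norm_nonneg _).trans h1
    simp only [hT]
    split_ifs with h
    · rw [norm_zero]; positivity
    · rw [norm_div, div_eq_mul_inv]
      gcongr
      rw [← inv_div]
      exact inv_anti₀ (by linarith) (hdist s hs n h)
  have hTd : DifferentiableOn ℂ (fun s => ∑' n, T n s) V := by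
    refine differentiableOn_tsum_of_summable_norm (hu.mul_right (2 / ε)) (fun n => ?_) hVo hTb
    by_cases h : n = m
    · simp only [hT, h, if_true]
      exact differentiableOn_const _
    · simp only [hT, h, if_false]
      refine ((hd n).mono fun s hs => hKU (interior_subset hs.1)).div (by fun_prop) fun s hs h0 => ?_
      have := hdist s hs n h
      rw [h0, norm_zero] at this
      linarith
  have h1 := hasPolarPart_div_sub ((hd m).analyticAt (hU.mem_nhds hz)) (p m)
  have h2 := hasPolarPart_of_analyticAt (hTd.analyticAt (hVo.mem_nhds hzV))
  refine (add_zero (if p m = z then F m z else 0)) ▸ (h1.add h2).congr ?_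
  filter_upwards [nhdsWithin_le_nhds (hVo.mem_nhds hzV)] with s hs
  have hsum : Summable fun n => F n s / (s - p n) := by
    have hTs : Summable fun n => T n s :=
      Summable.of_norm_bounded (hu.mul_right (2 / ε)) fun n => hTb n s hs
    refine hTs.congr_cofinite ?_
    have : ∀ᶠ n : ℕ in cofinite, n ≠ m := by rw [eventually_cofinite]; simp
    filter_upwards [this] with n hn
    simp [hT, hn]
  exact hsum.tsum_eq_add_tsum_ite m

lemma differentiableOn_Gamma_one_sub :
    DifferentiableOn ℂ (fun s => Gamma (1 - s)) {s | s.re < 1} := by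
  intro s hs
  have hs : s.re < 1 := hs
  have hG : DifferentiableAt ℂ Gamma (1 - s) := by
    refine differentiableAt_Gamma _ fun m h => ?_
    have := congrArg re h
    simp only [sub_re, one_re, neg_re, natCast_re] at this
    have h1 : (0 : ℝ) ≤ m := m.cast_nonneg
    linarith
  exact (hG.comp (f := fun s : ℂ => 1 - s) s (by fun_prop)).differentiableWithinAt

/-- The indices l and m are the only candidates for a pole at z in the two series; if a candidate
misses z, its contribution is zero. This lets one statement serve every point of Re z < 1. -/
lemma gammaWitten_hasPolarPart {z : ℂ} (hz : z.re < 1) (l m : ℕ)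
    (hl : ∀ n : ℕ, n ≠ l → (1 - n : ℂ) / 2 ≠ z) (hm : ∀ n : ℕ, n ≠ m → (-n : ℂ) ≠ z) :
    HasPolarPart gammaWitten z ((if (2 / 3 : ℂ) = z then Gamma (1 - z) ^ 2 / 3 else 0) +
      (if (1 - l : ℂ) / 2 = z then Gamma (1 - z) * zetaCoeff l z else 0) +
      (if (-m : ℂ) = z then convCoeff m z else 0)) := by
  have hU : IsOpen {s : ℂ | s.re < 1} := isOpen_lt continuous_re continuous_const
  have hG := differentiableOn_Gamma_one_sub
  have t1 : HasPolarPart (fun s => ∑' p, tailTerm s p) z 0 :=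
    hasPolarPart_of_analyticAt (differentiable_tsum_tailTerm.analyticAt z)
  have t2 := hasPolarPart_div_sub (((hG.pow 2).div_const 3).analyticAt (hU.mem_nhds hz)) (2 / 3)
  have hnat : Tendsto (fun n : ℕ => (n : ℝ)) atTop atTop := tendsto_natCast_atTop_atTop
  have t3 := hasPolarPart_tsum (F := fun n s => Gamma (1 - s) * zetaCoeff n s)
    (p := fun n : ℕ => (1 - n : ℂ) / 2) hU (fun n => hG.mul (differentiableOn_zetaCoeff n))
    (fun K hKU hK => by
      obtain ⟨C, _, hC⟩ := exists_zetaCoeff_bound hK hKU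
      obtain ⟨B, hB⟩ := hK.exists_bound_of_continuousOn (hG.continuousOn.mono hKU)
      refine ⟨_, (summable_geometric_two.mul_left C).mul_left |B|, fun n s hs => ?_⟩
      rw [norm_mul]
      gcongr
      · exact (hB s hs).trans (le_abs_self B)
      · exact hC n s hs)
    (by
      refine tendsto_atTop_mono (fun n => ?_)
        ((tendsto_atTop_add_const_right _ (-1) hnat).atTop_div_const two_pos)
      rw [norm_div, RCLike.norm_ofNat]
      have := norm_sub_norm_le (n : ℂ) 1
      rw [norm_natCast, norm_one, norm_sub_rev] at this
      gcongr
      linarith) hz l hl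
  have t4 := hasPolarPart_tsum (F := convCoeff) (p := fun n : ℕ => (-n : ℂ)) hU
    differentiableOn_convCoeff
    (fun K hKU hK => by
      obtain ⟨C, _, hC⟩ := exists_convCoeff_bound hK hKU
      exact ⟨_, summable_succ_mul_geometric_half.mul_left C, hC⟩)
    (by simpa using hnat) hz m hm
  have h := ((t1.add t2).add t3).add t4
  rw [zero_add] at h
  exact h

end PolarParts

/-! ### Existence and uniqueness of the continuation. -/

section Continuation

open Complex Set

lemma isOpen_re_lt_one : IsOpen {s : ℂ | s.re < 1} := isOpen_lt continuous_re continuous_const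

lemma exists_gammaWitten_hasPolarPart {z : ℂ} (hz : z.re < 1) : ∃ c, HasPolarPart gammaWitten z c := by
  have key : ∀ f : ℕ → ℂ, Function.Injective f → ∃ m, ∀ n, n ≠ m → f n ≠ z := by
    intro f hf
    by_cases h : ∃ m, f m = z
    · obtain ⟨m, rfl⟩ := h
      exact ⟨m, fun n hn => hf.ne hn⟩
    · push Not at h
      exact ⟨0, fun n _ => h n⟩
  obtain ⟨l, hl⟩ := key (fun n => (1 - n : ℂ) / 2) fun a b h => by
    have : (a : ℂ) = b := by linear_combination (-2) * h
    exact_mod_cast this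
  obtain ⟨m, hm⟩ := key (fun n => (-n : ℂ)) fun a b h => by simpa using h
  exact ⟨_, gammaWitten_hasPolarPart hz l m hl hm⟩

/-- A meromorphic continuation of the Witten zeta function. -/
noncomputable def wittenZeta (s : ℂ) : ℂ :=
  open Classical in if 2 / 3 < s.re then ∑' p, wittenTerm s p else (Gamma s)⁻¹ * gammaWitten s

lemma wittenZeta_eq_of_re_lt {s : ℂ} (hs : s.re < 1) :
    wittenZeta s = (Gamma s)⁻¹ * gammaWitten s := by
  rw [wittenZeta]
  split_ifs with h
  · rw [← Gamma_mul_tsum_wittenTerm_eq_gammaWitten h hs, inv_mul_cancel_left₀]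
    exact Gamma_ne_zero_of_re_pos (by linarith)
  · rfl

theorem isWittenZeta_wittenZeta : IsWittenZeta wittenZeta where
  meromorphicAt z := by
    by_cases h : 2 / 3 < z.re
    · have hV : IsOpen {s : ℂ | 2 / 3 < s.re} := isOpen_lt continuous_const continuous_re
      refine ((differentiableOn_tsum_wittenTerm.analyticAt (hV.mem_nhds h)).congr
        ?_).meromorphicAt
      filter_upwards [hV.mem_nhds h] with s hs
      exact (if_pos hs).symm
    · have hz : z.re < 1 := by linarith
      obtain ⟨c, hc⟩ := exists_gammaWitten_hasPolarPart hz
      have hG : MeromorphicAt (fun s => (Gamma s)⁻¹) z :=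
        (differentiable_one_div_Gamma.analyticAt z).meromorphicAt
      refine (hG.mul hc.meromorphicAt).congr ?_
      filter_upwards [nhdsWithin_le_nhds (isOpen_re_lt_one.mem_nhds hz)] with s hs
      exact (wittenZeta_eq_of_re_lt hs).symm
  hasSum s hs := by
    rw [wittenZeta, if_pos hs]
    exact (summable_wittenTerm hs).hasSum

lemma meromorphicAt_Gamma (z : ℂ) : MeromorphicAt Gamma z := by
  have := (differentiable_one_div_Gamma.analyticAt z).meromorphicAt.inv
  refine this.congr (Eventually.of_forall fun s => ?_)
  simp

/-- Every continuation of the series agrees with `gammaWitten / Γ` on the half plane `Re s < 1`. -/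
lemma Gamma_mul_eventuallyEq_gammaWitten {ω : ℂ → ℂ} (hω : IsWittenZeta ω) {z : ℂ} (hz : z.re < 1) :
    (fun s => Gamma s * ω s) =ᶠ[𝓝[≠] z] gammaWitten := by
  have hM : MeromorphicOn (fun s => Gamma s * ω s - gammaWitten s) {s | s.re < 1} := by
    intro s hs
    obtain ⟨c, hc⟩ := exists_gammaWitten_hasPolarPart hs
    exact ((meromorphicAt_Gamma s).mul (hω.meromorphicAt s)).sub hc.meromorphicAt
  -- The point 5/6 lies in the strip where both functions are given by the series. A meromorphic
  -- function on a connected set has infinite order everywhere once it does at one point.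
  have h56 : meromorphicOrderAt (fun s => Gamma s * ω s - gammaWitten s) (5 / 6) = ⊤ := by
    rw [meromorphicOrderAt_eq_top_iff]
    refine eventually_nhdsWithin_of_eventually_nhds ?_
    have hV : IsOpen {s : ℂ | 2 / 3 < s.re ∧ s.re < 1} :=
      (isOpen_lt continuous_const continuous_re).inter isOpen_re_lt_one
    filter_upwards [hV.mem_nhds (show 2 / 3 < ((5 / 6 : ℂ)).re ∧ ((5 / 6 : ℂ)).re < 1 by
      norm_num)] with s hs
    rw [← (hω.hasSum s hs.1).tsum_eq, Gamma_mul_tsum_wittenTerm_eq_gammaWitten hs.1 hs.2, sub_self]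
  have htop : meromorphicOrderAt (fun s => Gamma s * ω s - gammaWitten s) z = ⊤ := by
    by_contra h
    exact hM.meromorphicOrderAt_ne_top_of_isPreconnected (convex_halfSpace_re_lt 1).isPreconnected
      hz (show ((5 / 6 : ℂ)).re < 1 by norm_num) h h56
  rw [meromorphicOrderAt_eq_top_iff] at htop
  filter_upwards [htop] with s hs
  exact sub_eq_zero.mp hs

lemma isRegularAt_of_two_thirds_lt {ω : ℂ → ℂ} (hω : IsWittenZeta ω) {z : ℂ} (hz : 2 / 3 < z.re) :
    IsRegularAt (fun s => Gamma s * ω s) z := by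
  have hV : IsOpen {s : ℂ | 2 / 3 < s.re} := isOpen_lt continuous_const continuous_re
  refine ⟨fun s => Gamma s * ∑' p, wittenTerm s p, ?_, ?_⟩
  · refine DifferentiableOn.analyticAt (s := {s : ℂ | 2 / 3 < s.re}) ?_ (hV.mem_nhds hz)
    refine DifferentiableOn.mul (fun s hs => ?_) differentiableOn_tsum_wittenTerm
    refine (differentiableAt_Gamma s fun m h => ?_).differentiableWithinAt
    have := congrArg re h
    simp only [neg_re, natCast_re] at this
    have h1 : (0 : ℝ) ≤ m := m.cast_nonneg
    linarith [show 2 / 3 < s.re from hs]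
  · filter_upwards [nhdsWithin_le_nhds (hV.mem_nhds hz)] with s hs
    rw [(hω.hasSum s hs).tsum_eq]

end Continuation

end WittenZeta

namespace WittenZeta

/-! ### Nonvanishing of ζ at 1/2 - 3k. -/

section ZetaNonvanishing

open Complex Set

/-- The real series `Li_{1/2}(e^{-t})`. -/
noncomputable def halfPolyLogTerm (t : ℝ) (n : ℕ) : ℝ :=
  ((n : ℝ) + 1) ^ (-(1 / 2) : ℝ) * Real.exp (-((n + 1) * t))

lemma polyLog_half_term (t : ℝ) (n : ℕ) :
    (((n.succPNat : ℕ) : ℂ)) ^ (-(1 / 2) : ℂ) * exp (-((n.succPNat : ℕ) * t)) =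
      (halfPolyLogTerm t n : ℂ) := by
  rw [halfPolyLogTerm, Nat.succPNat_coe, Nat.succ_eq_add_one]
  push_cast
  rw [ofReal_cpow (by positivity)]
  push_cast
  rfl

lemma hasSum_halfPolyLogTerm {t : ℝ} (ht : 0 < t) :
    HasSum (fun n => (halfPolyLogTerm t n : ℂ)) (polyLog (1 / 2) t) := by
  have h := (summable_polyLog (1 / 2) ht).hasSum
  rw [← Equiv.pnatEquivNat.symm.hasSum_iff] at h
  refine h.congr_fun fun n => ?_
  exact (polyLog_half_term t n).symm

lemma summable_halfPolyLogTerm {t : ℝ} (ht : 0 < t) : Summable (halfPolyLogTerm t) :=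
  summable_ofReal.mp (hasSum_halfPolyLogTerm ht).summable

lemma polyLog_half_eq {t : ℝ} (ht : 0 < t) :
    polyLog (1 / 2) t = ((∑' n, halfPolyLogTerm t n : ℝ) : ℂ) := by
  rw [← (hasSum_halfPolyLogTerm ht).tsum_eq, ofReal_tsum]

lemma sqrt_two_mul_halfPolyLogTerm (t : ℝ) (n : ℕ) :
    Real.sqrt 2 * halfPolyLogTerm (2 * t) n = 2 * halfPolyLogTerm t (2 * n + 1) := by
  have h2 : (2 : ℝ) ^ (-(1 / 2) : ℝ) = Real.sqrt 2 / 2 := by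
    rw [Real.rpow_neg zero_le_two, ← Real.sqrt_eq_rpow, eq_div_iff two_ne_zero,
      inv_mul_eq_iff_eq_mul₀ (by positivity), Real.mul_self_sqrt zero_le_two]
  have h3 : ((2 * n + 1 : ℕ) : ℝ) + 1 = 2 * ((n : ℝ) + 1) := by push_cast; ring
  rw [halfPolyLogTerm, halfPolyLogTerm, h3, Real.mul_rpow zero_le_two (by positivity), h2,
    show 2 * ((n : ℝ) + 1) * t = (n + 1) * (2 * t) by ring]
  ring

lemma halfPolyLogTerm_antitone {t : ℝ} (ht : 0 < t) : Antitone (halfPolyLogTerm t) := by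
  intro a b hab
  have h : (a : ℝ) ≤ b := by exact_mod_cast hab
  rw [halfPolyLogTerm, halfPolyLogTerm]
  refine mul_le_mul (Real.rpow_le_rpow_of_nonpos (by positivity) (by linarith) (by norm_num))
    (Real.exp_le_exp.mpr ?_) (by positivity) (by positivity)
  nlinarith

/-- The right side is the alternating series of the terms n^(-1/2) e^{-nt}, n ≥ 1. Grouped in
consecutive pairs it has nonnegative terms, and the first pair gives a bound uniform in t. -/
lemma alternating_lower_bound {t : ℝ} (ht : 0 < t) (ht' : t ≤ 1) :
    Real.exp (-1) * (1 - (2 : ℝ) ^ (-(1 / 2) : ℝ)) ≤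
      ∑' n, halfPolyLogTerm t n - Real.sqrt 2 * ∑' n, halfPolyLogTerm (2 * t) n := by
  have hS := summable_halfPolyLogTerm ht
  have hE : Summable fun n => halfPolyLogTerm t (2 * n) :=
    hS.comp_injective fun a b h => by simpa using h
  have hO : Summable fun n => halfPolyLogTerm t (2 * n + 1) :=
    hS.comp_injective (i := fun n => 2 * n + 1) fun a b h => by simpa using h
  have e : ∑' n, halfPolyLogTerm t n - Real.sqrt 2 * ∑' n, halfPolyLogTerm (2 * t) n =
      ∑' n, (halfPolyLogTerm t (2 * n) - halfPolyLogTerm t (2 * n + 1)) := by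
    rw [← tsum_mul_left, tsum_congr (sqrt_two_mul_halfPolyLogTerm t), tsum_mul_left,
      ← tsum_even_add_odd hE hO, hE.tsum_sub hO]
    ring
  have hle : halfPolyLogTerm t (2 * 0) - halfPolyLogTerm t (2 * 0 + 1) ≤
      ∑' n, (halfPolyLogTerm t (2 * n) - halfPolyLogTerm t (2 * n + 1)) :=
    (hE.sub hO).le_tsum 0 fun n _ =>
      sub_nonneg.mpr (halfPolyLogTerm_antitone ht (Nat.le_succ _))
  rw [e]
  refine le_trans ?_ hle
  have h0 : halfPolyLogTerm t (2 * 0) = Real.exp (-t) := by simp [halfPolyLogTerm]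
  have h1 : halfPolyLogTerm t (2 * 0 + 1) ≤ (2 : ℝ) ^ (-(1 / 2) : ℝ) * Real.exp (-t) := by
    rw [halfPolyLogTerm]
    norm_num
    gcongr
    linarith
  have h2 : (2 : ℝ) ^ (-(1 / 2) : ℝ) ≤ 1 :=
    Real.rpow_le_one_of_one_le_of_nonpos one_le_two (by norm_num)
  have h3 : Real.exp (-1) ≤ Real.exp (-t) := Real.exp_le_exp.mpr (by linarith)
  rw [h0]
  nlinarith

lemma tendsto_tsum_zetaCoeff {s : ℂ} (hs : s.re < 1) :
    Tendsto (fun t : ℝ => ∑' n, zetaCoeff n s * (t : ℂ) ^ n) (𝓝[>] 0) (𝓝 (riemannZeta s)) := by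
  have hc : ContinuousOn (fun t : ℝ => ∑' n, zetaCoeff n s * (t : ℂ) ^ n) (Icc 0 1) := by
    refine continuousOn_tsum (fun n => by fun_prop) (summable_zetaCoeff hs) fun n t ht => ?_
    rw [norm_mul, norm_pow, norm_real, Real.norm_of_nonneg ht.1]
    exact mul_le_of_le_one_right (norm_nonneg _) (pow_le_one₀ ht.1 ht.2)
  have h := (hc 0 ⟨le_rfl, zero_le_one⟩).tendsto
  have h0 : ∑' n, zetaCoeff n s * ((0 : ℝ) : ℂ) ^ n = riemannZeta s := by
    rw [tsum_eq_single 0 fun n hn => by simp [hn]]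
    simp [zetaCoeff]
  rw [h0] at h
  refine h.mono_left ?_
  rw [nhdsWithin_le_iff]
  exact mem_of_superset (Ioc_mem_nhdsGT zero_lt_one) Ioc_subset_Icc_self

/-- The regular part D(t) of Li_{1/2}(e^{-t}) tends to ζ(1/2). In Li(t) - √2 Li(2t) the singular
terms cancel, as √2 (2t)^(-1/2) = t^(-1/2); if ζ(1/2) were 0 this difference would tend to 0,
against the uniform lower bound. -/
theorem riemannZeta_one_half_ne_zero : riemannZeta (1 / 2) ≠ 0 := by
  intro hζ
  have hs : ((1 / 2 : ℂ)).re < 1 := by norm_num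
  set D : ℝ → ℂ := fun t => ∑' n, zetaCoeff n (1 / 2) * (t : ℂ) ^ n with hD
  have h1 : Tendsto D (𝓝[>] 0) (𝓝 0) := hζ ▸ tendsto_tsum_zetaCoeff hs
  have h2 : Tendsto (fun t : ℝ => D (2 * t)) (𝓝[>] 0) (𝓝 0) := by
    refine h1.comp (tendsto_nhdsWithin_iff.mpr ⟨?_, ?_⟩)
    · have : Tendsto (fun t : ℝ => 2 * t) (𝓝 0) (𝓝 (2 * 0)) := tendsto_id.const_mul 2
      rw [mul_zero] at this
      exact this.mono_left nhdsWithin_le_nhds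
    · filter_upwards [self_mem_nhdsWithin] with t ht
      exact mem_Ioi.mpr (mul_pos two_pos (mem_Ioi.mp ht))
  have h3 : Tendsto (fun t : ℝ => (D t - (Real.sqrt 2 : ℂ) * D (2 * t)).re) (𝓝[>] 0) (𝓝 0) := by
    have := (h1.sub (h2.const_mul (Real.sqrt 2 : ℂ)))
    rw [mul_zero, sub_zero] at this
    exact (continuous_re.tendsto 0).comp this
  have hpos : 0 < Real.exp (-1) * (1 - (2 : ℝ) ^ (-(1 / 2) : ℝ)) := by
    have := Real.rpow_lt_one_of_one_lt_of_neg one_lt_two (show (-(1 / 2) : ℝ) < 0 by norm_num)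
    have h := Real.exp_pos (-1)
    exact mul_pos h (by linarith)
  refine absurd (ge_of_tendsto h3 ?_) (not_le.mpr hpos)
  filter_upwards [Ioc_mem_nhdsGT (show (0 : ℝ) < 1 / 2 by norm_num)] with t ht
  refine (alternating_lower_bound ht.1 (by linarith [ht.2])).trans (le_of_eq ?_)
  have ht2 : 0 < 2 * t := by linarith [ht.1]
  have e1 := polyLog_expansion hs ht.1 (by linarith [ht.2])
  have e2 := polyLog_expansion hs ht2 (by linarith [ht.2])
  have hc : ((2 * t : ℝ) : ℂ) ^ (1 / 2 - 1 : ℂ) * (Real.sqrt 2 : ℂ) = (t : ℂ) ^ (1 / 2 - 1 : ℂ) := by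
    rw [ofReal_mul, mul_cpow_ofReal_nonneg zero_le_two ht.1.le, Real.sqrt_eq_rpow,
      ofReal_cpow zero_le_two, mul_right_comm, ← cpow_add _ _ (by norm_num)]
    norm_num
  have e3 : D t - (Real.sqrt 2 : ℂ) * D (2 * t) =
      polyLog (1 / 2) t - (Real.sqrt 2 : ℂ) * polyLog (1 / 2) (2 * t) := by
    rw [e1, e2, ← hc]
    simp only [hD]
    ring
  rw [e3, polyLog_half_eq ht.1, polyLog_half_eq ht2, ← ofReal_mul, ← ofReal_sub, ofReal_re]

theorem riemannZeta_half_sub_ne_zero (k : ℕ) : riemannZeta ((1 - 6 * (k : ℂ)) / 2) ≠ 0 := by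
  rcases Nat.eq_zero_or_pos k with rfl | hk
  · simpa using riemannZeta_one_half_ne_zero
  have hk1 : (1 : ℝ) ≤ k := by exact_mod_cast hk
  set w : ℂ := 1 / 2 + 3 * k with hw
  have hre : w.re = 1 / 2 + 3 * k := by simp [hw]
  have h : (1 - 6 * (k : ℂ)) / 2 = 1 - w := by rw [hw]; ring
  have hpi : (Real.pi : ℂ) ≠ 0 := by exact_mod_cast Real.pi_ne_zero
  rw [h, riemannZeta_one_sub]
  · refine mul_ne_zero (mul_ne_zero (mul_ne_zero (mul_ne_zero two_ne_zero ?_) ?_) ?_) ?_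
    · rw [Ne, cpow_eq_zero_iff]
      simp [hpi]
    · exact Gamma_ne_zero_of_re_pos (by rw [hre]; positivity)
    -- A zero of the cosine would force 1 + 6k = 4j + 2, impossible by parity.
    · rw [Ne, cos_eq_zero_iff]
      rintro ⟨j, hj⟩
      have h2 : (1 + 6 * (k : ℂ)) = 4 * (j : ℂ) + 2 := by
        rw [hw] at hj
        field_simp at hj
        linear_combination hj
      have h3 : (1 + 6 * (k : ℤ)) = 4 * j + 2 := by exact_mod_cast h2
      omega
    · exact riemannZeta_ne_zero_of_one_le_re (by rw [hre]; linarith)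
  · intro n hn
    have := congrArg re hn
    rw [hre] at this
    simp only [neg_re, natCast_re] at this
    have h1 : (0 : ℝ) ≤ n := n.cast_nonneg
    linarith
  · intro h1
    have := congrArg re h1
    rw [hre, one_re] at this
    linarith

end ZetaNonvanishing

/-! ### Residues at negative integers and Bernoulli numbers. -/

section NegativeIntegers

open Complex

lemma riemannZeta_neg_nat_eq_zetaNeg {l : ℕ} (hl : l ≠ 0) :
    riemannZeta (-(l : ℂ)) = (zetaNeg l : ℂ) := by
  rw [riemannZeta_neg_nat_eq_bernoulli', ← bernoulli_eq_bernoulli'_of_ne_one (by omega), zetaNeg]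
  push_cast
  ring

/-- The residue of `Γ(s) ω(s)` at `s = -m`, as a rational number. -/
noncomputable def residueAtNeg (m : ℕ) : ℚ :=
  (-1) ^ m / m.factorial * ∑ k ∈ Finset.range (m + 1),
    (m.choose k : ℚ) * (zetaNeg (m + k) * zetaNeg (2 * m - k)) -
      m.factorial / (2 * m + 1).factorial * zetaNeg (3 * m + 1)

lemma zetaCoeff_neg_nat (n : ℕ) {m : ℕ} (hm : m ≠ 0) :
    zetaCoeff n (-(m : ℂ)) = (-1) ^ n * (zetaNeg (m + n) : ℂ) / n.factorial := by
  rw [zetaCoeff, ← riemannZeta_neg_nat_eq_zetaNeg (by omega : m + n ≠ 0)]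
  congr 3
  push_cast
  ring

/-- The two fractions with a pole at -m are the cross term 2m+1, whose odd index gives the minus
sign, and the m-th convolution term, whose factorials combine into binomials. -/
lemma polar_coefficient_neg_nat {m : ℕ} (hm : m ≠ 0) :
    Gamma (1 - -(m : ℂ)) * zetaCoeff (2 * m + 1) (-(m : ℂ)) + convCoeff m (-(m : ℂ)) =
      (residueAtNeg m : ℂ) := by
  rw [sub_neg_eq_add, add_comm (1 : ℂ), Gamma_nat_eq_factorial, zetaCoeff_neg_nat _ hm, convCoeff,
    residueAtNeg, add_comm, sub_eq_add_neg]
  push_cast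
  congr 1
  · rw [Finset.mul_sum]
    refine Finset.sum_congr rfl fun k hk => ?_
    have hk : k ≤ m := by simpa [Nat.lt_succ_iff] using hk
    rw [zetaCoeff_neg_nat _ hm, zetaCoeff_neg_nat _ hm, show m + (m - k) = 2 * m - k by omega,
      Nat.cast_choose ℂ hk]
    have h1 : (m.factorial : ℂ) ≠ 0 := by exact_mod_cast m.factorial_ne_zero
    have h2 : (k.factorial : ℂ) ≠ 0 := by exact_mod_cast k.factorial_ne_zero
    have h3 : ((m - k).factorial : ℂ) ≠ 0 := by exact_mod_cast (m - k).factorial_ne_zero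
    have h4 : (-1 : ℂ) ^ m = (-1) ^ k * (-1) ^ (m - k) := by
      rw [← pow_add, Nat.add_sub_cancel' hk]
    rw [h4]
    field_simp
  · rw [show m + (2 * m + 1) = 3 * m + 1 by ring, pow_succ, pow_mul]
    norm_num
    ring

lemma sum_range_eq_sum_odd (f : ℕ → ℚ) (hf : ∀ j, Even j → f j = 0) (n : ℕ) :
    ∑ j ∈ Finset.range (2 * n + 1), f j = ∑ k ∈ Finset.Icc 1 n, f (2 * k - 1) := by
  induction n with
  | zero => simp [hf 0 Even.zero]
  | succ n ih =>
    rw [show 2 * (n + 1) + 1 = 2 * n + 1 + 1 + 1 by ring, Finset.sum_range_succ,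
      Finset.sum_range_succ, ih, Finset.sum_Icc_succ_top (by omega),
      hf (2 * n + 1 + 1) ⟨n + 1, by ring⟩, add_zero, show 2 * (n + 1) - 1 = 2 * n + 1 by omega]

lemma bernoulli_div_eq (l : ℕ) : bernoulli (l + 1) / ((l : ℚ) + 1) = -zetaNeg l := by
  rw [zetaNeg]; ring

/-- For even k the factor `zetaNeg (2 * n + k)` vanishes, so only the odd indices 2k-1 survive and
the residue formula becomes the stated sum. -/
lemma bernoulliIdentity_iff {n : ℕ} (hn : 1 ≤ n) :
    BernoulliIdentity n ↔ residueAtNeg (2 * n) = 0 := by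
  have hsum : ∑ k ∈ Finset.range (2 * n + 1),
      ((2 * n).choose k : ℚ) * (zetaNeg (2 * n + k) * zetaNeg (2 * (2 * n) - k)) =
      ∑ k ∈ Finset.Icc 1 n, (Nat.choose (2 * n) (2 * k - 1) : ℚ) *
        (bernoulli (2 * n + 2 * k) / (2 * n + 2 * k : ℚ)) *
        (bernoulli (4 * n - 2 * k + 2) / (4 * n - 2 * k + 2 : ℚ)) := by
    rw [sum_range_eq_sum_odd]
    · refine Finset.sum_congr rfl fun k hk => ?_
      obtain ⟨hk1, hk2⟩ := Finset.mem_Icc.mp hk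
      have e1 := bernoulli_div_eq (2 * n + (2 * k - 1))
      have e2 := bernoulli_div_eq (2 * (2 * n) - (2 * k - 1))
      rw [show 2 * n + (2 * k - 1) + 1 = 2 * n + 2 * k by omega] at e1
      rw [show 2 * (2 * n) - (2 * k - 1) + 1 = 4 * n - 2 * k + 2 by omega] at e2
      have c1 : ((2 * n + (2 * k - 1) : ℕ) : ℚ) + 1 = 2 * n + 2 * k := by
        exact_mod_cast (show 2 * n + (2 * k - 1) + 1 = 2 * n + 2 * k by omega)
      have c2 : ((2 * (2 * n) - (2 * k - 1) : ℕ) : ℚ) + 1 = 4 * n - 2 * k + 2 := by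
        rw [eq_comm, sub_add_eq_add_sub, sub_eq_iff_eq_add]
        exact_mod_cast (show 4 * n + 2 = 2 * (2 * n) - (2 * k - 1) + 1 + 2 * k by omega)
      rw [c1] at e1
      rw [c2] at e2
      rw [e1, e2]
      ring
    · intro j hj
      rw [zetaNeg_eq_zero_of_even (by omega) ((even_two_mul n).add hj)]
      ring
  have e := bernoulli_div_eq (6 * n + 1)
  have c : ((6 * n + 1 : ℕ) : ℚ) + 1 = 6 * n + 2 := by push_cast; ring
  rw [c] at e
  rw [BernoulliIdentity, ← hsum, residueAtNeg, e, (even_two_mul n).neg_one_pow,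
    show 3 * (2 * n) + 1 = 6 * n + 1 by ring, show 2 * (2 * n) + 1 = 4 * n + 1 by ring]
  have h1 : ((2 * n).factorial : ℚ) ≠ 0 := by exact_mod_cast (2 * n).factorial_ne_zero
  have h2 : ((4 * n + 1).factorial : ℚ) ≠ 0 := by exact_mod_cast (4 * n + 1).factorial_ne_zero
  rw [sub_eq_zero]
  field_simp
  constructor <;> intro h <;> linarith

/-- For odd m one of m+k and 2m-k is even for every k, and 3m+1 is even, so each term contains a
trivial zero of ζ. -/
theorem residueAtNeg_of_odd {m : ℕ} (hm : Odd m) : residueAtNeg m = 0 := by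
  have hm0 : m ≠ 0 := by rintro rfl; simp at hm
  have h1 : ∀ k ∈ Finset.range (m + 1),
      (m.choose k : ℚ) * (zetaNeg (m + k) * zetaNeg (2 * m - k)) = 0 := by
    intro k hk
    have hk : k ≤ m := by simpa [Nat.lt_succ_iff] using hk
    rcases Nat.even_or_odd k with h | h
    · rw [zetaNeg_eq_zero_of_even (l := 2 * m - k) (by omega)
        ((Nat.even_sub (by omega)).mpr (by simp [h]))]
      ring
    · rw [zetaNeg_eq_zero_of_even (by omega) (hm.add_odd h)]
      ring
  rw [residueAtNeg, Finset.sum_eq_zero h1, zetaNeg_eq_zero_of_even (by omega)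
    ((Nat.odd_mul.mpr ⟨by decide, hm⟩).add_one)]
  ring

theorem residueAtNeg_of_even {m : ℕ} (hm : m ≠ 0) (he : Even m) : residueAtNeg m = 0 := by
  rw [residueAtNeg, sum_choose_zetaNeg_mul m hm he, he.neg_one_pow]
  have h1 : (m.factorial : ℚ) ≠ 0 := by exact_mod_cast m.factorial_ne_zero
  field_simp
  ring

end NegativeIntegers

/-! ### The poles of Γ(s) ω(s). -/

section Poles

open Complex

variable {ω : ℂ → ℂ}

lemma Gamma_half_add (k : ℕ) :
    Gamma (1 / 2 + k) * (4 ^ k * k.factorial) = (2 * k).factorial * (Real.sqrt Real.pi : ℂ) := by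
  induction k with
  | zero =>
    have := Complex.Gamma_ofReal (1 / 2)
    rw [Real.Gamma_one_half_eq] at this
    push_cast at this
    simpa using this
  | succ k ih =>
    have h0 : (1 / 2 + k : ℂ) ≠ 0 := by
      intro h
      have := congrArg re h
      simp only [add_re, natCast_re, zero_re] at this
      norm_num at this
      have h1 : (0 : ℝ) ≤ k := k.cast_nonneg
      linarith
    rw [Nat.cast_succ, ← add_assoc, Gamma_add_one _ h0, Nat.factorial_succ,
      show 2 * (k + 1) = 2 * k + 1 + 1 by ring, Nat.factorial_succ, Nat.factorial_succ]
    push_cast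
    linear_combination (2 * ((k : ℂ) + 1) * (2 * k + 1)) * ih

lemma pole_two_thirds (hω : IsWittenZeta ω) :
    HasSimplePoleWithResidue (fun s => Gamma s * ω s) (2 / 3) (Gamma (1 / 3) ^ 2 / 3) := by
  have hre : ((2 / 3 : ℂ)).re = 2 / 3 := by norm_num
  have h1 : ∀ n : ℕ, (1 - n : ℂ) / 2 ≠ 2 / 3 := fun n h => by
    have h3 : (3 * (1 - (n : ℤ))) = 4 := by
      have : (3 * (1 - (n : ℂ))) = 4 := by linear_combination 6 * h
      exact_mod_cast this
    omega
  have h2 : ∀ n : ℕ, (-n : ℂ) ≠ 2 / 3 := fun n h => by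
    have h3 : (3 * (-(n : ℤ))) = 2 := by
      have : (3 * (-(n : ℂ))) = 2 := by linear_combination 3 * h
      exact_mod_cast this
    omega
  have h := gammaWitten_hasPolarPart (by rw [hre]; norm_num) 0 0 (fun n _ => h1 n) (fun n _ => h2 n)
  rw [if_pos rfl, if_neg (h1 0), if_neg (h2 0), add_zero, add_zero,
    show (1 - 2 / 3 : ℂ) = 1 / 3 by norm_num] at h
  refine (h.congr (Gamma_mul_eventuallyEq_gammaWitten hω (by rw [hre]; norm_num))).hasSimplePole ?_
  have : Gamma (1 / 3) ≠ 0 := Gamma_ne_zero_of_re_pos (by norm_num)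
  exact div_ne_zero (pow_ne_zero 2 this) three_ne_zero

lemma pole_zero (hω : IsWittenZeta ω) :
    HasSimplePoleWithResidue (fun s => Gamma s * ω s) 0 (1 / 3) := by
  have h := gammaWitten_hasPolarPart (z := 0) (by simp) 1 0 (fun n hn h => hn ?_)
    (fun n hn h => hn (by simpa using h))
  -- The two contributions are -ζ(-1) = 1/12 and ζ(0)^2 = 1/4.
  · have hc : Gamma (1 - 0) * zetaCoeff 1 0 + convCoeff 0 0 = 1 / 3 := by
      have h1 : riemannZeta (-1) = -1 / 12 := by
        have := riemannZeta_neg_nat_eq_bernoulli' 1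
        norm_num [bernoulli'_two] at this
        rw [this]
        norm_num
      simp [zetaCoeff, convCoeff, riemannZeta_zero, h1]
      norm_num
    rw [if_neg (by norm_num), if_pos (by norm_num), if_pos (by norm_num), zero_add, hc] at h
    exact (h.congr (Gamma_mul_eventuallyEq_gammaWitten hω (by simp))).hasSimplePole (by norm_num)
  · have : (n : ℂ) = 1 := by linear_combination (-2) * h
    exact_mod_cast this

lemma pole_half_sub (hω : IsWittenZeta ω) (k : ℕ) :
    HasSimplePoleWithResidue (fun s => Gamma s * ω s) (1 / 2 - (k : ℂ))
      ((Real.sqrt Real.pi : ℂ) * riemannZeta ((1 - 6 * (k : ℂ)) / 2) /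
        (4 ^ k * (Nat.factorial k : ℂ))) := by
  have hre : (1 / 2 - (k : ℂ)).re < 1 := by
    simp only [sub_re, natCast_re]
    norm_num
    have h1 : (0 : ℝ) ≤ k := k.cast_nonneg
    linarith
  have h1 : ∀ n : ℕ, n ≠ 2 * k → (1 - n : ℂ) / 2 ≠ 1 / 2 - k := fun n hn h => hn <| by
    have : (n : ℂ) = 2 * k := by linear_combination (-2) * h
    exact_mod_cast this
  have h2 : ∀ n : ℕ, (-n : ℂ) ≠ 1 / 2 - k := fun n h => by
    have h3 : (2 * (-(n : ℤ))) = 1 - 2 * k := by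
      have : (2 * (-(n : ℂ))) = 1 - 2 * k := by linear_combination 2 * h
      exact_mod_cast this
    omega
  have h3 : (2 / 3 : ℂ) ≠ 1 / 2 - k := fun h => by
    have h4 : (4 : ℤ) = 3 - 6 * k := by
      have : (4 : ℂ) = 3 - 6 * k := by linear_combination 6 * h
      exact_mod_cast this
    omega
  have h := gammaWitten_hasPolarPart hre (2 * k) 0 h1 (fun n _ => h2 n)
  have hk : (4 ^ k * (k.factorial : ℂ)) ≠ 0 :=
    mul_ne_zero (pow_ne_zero _ (by norm_num)) (by exact_mod_cast k.factorial_ne_zero)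
  have h2k : ((2 * k).factorial : ℂ) ≠ 0 := by exact_mod_cast (2 * k).factorial_ne_zero
  have hc : Gamma (1 - (1 / 2 - (k : ℂ))) * zetaCoeff (2 * k) (1 / 2 - (k : ℂ)) =
      (Real.sqrt Real.pi : ℂ) * riemannZeta ((1 - 6 * (k : ℂ)) / 2) /
        (4 ^ k * (Nat.factorial k : ℂ)) := by
    -- The constant comes from Γ(1/2 + k)/(2k)! = √π/(4^k k!).
    have hg := Gamma_half_add k
    rw [zetaCoeff, show 1 - (1 / 2 - (k : ℂ)) = 1 / 2 + k by ring,
      show (1 / 2 - (k : ℂ)) - ((2 * k : ℕ) : ℂ) = (1 - 6 * (k : ℂ)) / 2 by push_cast; ring,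
      pow_mul, neg_one_sq, one_pow, one_mul, eq_div_iff hk, mul_div_assoc', div_mul_eq_mul_div,
      div_eq_iff h2k]
    linear_combination riemannZeta ((1 - 6 * (k : ℂ)) / 2) * hg
  rw [if_neg h3, if_pos (by push_cast; ring), if_neg (h2 0), zero_add, add_zero, hc] at h
  refine (h.congr (Gamma_mul_eventuallyEq_gammaWitten hω hre)).hasSimplePole ?_
  refine div_ne_zero (mul_ne_zero ?_ (riemannZeta_half_sub_ne_zero k)) hk
  exact_mod_cast (Real.sqrt_pos.mpr Real.pi_pos).ne'

lemma hasPolarPart_neg_nat (hω : IsWittenZeta ω) {m : ℕ} (hm : 1 ≤ m) :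
    HasPolarPart (fun s => Gamma s * ω s) (-(m : ℂ)) (residueAtNeg m) := by
  have hre : (-(m : ℂ)).re < 1 := by
    simp only [neg_re, natCast_re]
    have h1 : (0 : ℝ) ≤ m := m.cast_nonneg
    linarith
  have h1 : ∀ n : ℕ, n ≠ 2 * m + 1 → (1 - n : ℂ) / 2 ≠ -m := fun n hn h => hn <| by
    have : (n : ℂ) = 2 * m + 1 := by linear_combination (-2) * h
    exact_mod_cast this
  have h3 : (2 / 3 : ℂ) ≠ -m := fun h => by
    have h4 : (2 : ℤ) = -(3 * m) := by
      have : (2 : ℂ) = -(3 * m) := by linear_combination 3 * h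
      exact_mod_cast this
    omega
  have h := gammaWitten_hasPolarPart hre (2 * m + 1) m h1 (fun n hn h => hn (by simpa using h))
  rw [if_neg h3, if_pos (by push_cast; ring), if_pos rfl, zero_add,
    polar_coefficient_neg_nat (by omega)] at h
  exact h.congr (Gamma_mul_eventuallyEq_gammaWitten hω hre)

lemma isRegularAt_neg_nat_iff (hω : IsWittenZeta ω) {m : ℕ} (hm : 1 ≤ m) :
    IsRegularAt (fun s => Gamma s * ω s) (-(m : ℂ)) ↔ residueAtNeg m = 0 := by
  rw [(hasPolarPart_neg_nat hω hm).isRegularAt_iff, Rat.cast_eq_zero]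

/-- Only even m carry information, odd m being regular unconditionally. -/
lemma forall_isRegularAt_neg_nat_iff (hω : IsWittenZeta ω) :
    (∀ m : ℕ, 1 ≤ m → IsRegularAt (fun s => Gamma s * ω s) (-(m : ℂ))) ↔
      ∀ n : ℕ, 1 ≤ n → BernoulliIdentity n := by
  constructor
  · intro h n hn
    have h2 := (isRegularAt_neg_nat_iff hω (by omega : 1 ≤ 2 * n)).mp (h _ (by omega))
    exact (bernoulliIdentity_iff hn).mpr h2
  · intro h m hm
    rw [isRegularAt_neg_nat_iff hω hm]
    rcases Nat.even_or_odd m with he | ho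
    · obtain ⟨n, rfl⟩ := he.two_dvd
      exact (bernoulliIdentity_iff (by omega)).mp (h n (by omega))
    · exact residueAtNeg_of_odd ho

theorem bernoulliIdentity {n : ℕ} (hn : 1 ≤ n) : BernoulliIdentity n :=
  (bernoulliIdentity_iff hn).mpr (residueAtNeg_of_even (by omega) (even_two_mul n))

lemma isRegularAt_of_ne (hω : IsWittenZeta ω) {z : ℂ} (h23 : z ≠ 2 / 3) (h0 : z ≠ 0)
    (hk : ∀ k : ℕ, z ≠ 1 / 2 - (k : ℂ)) : IsRegularAt (fun s => Gamma s * ω s) z := by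
  by_cases hz : 2 / 3 < z.re
  · exact isRegularAt_of_two_thirds_lt hω hz
  have hre : z.re < 1 := by linarith
  by_cases hm : ∃ m : ℕ, z = -(m : ℂ)
  · obtain ⟨m, rfl⟩ := hm
    have hm1 : 1 ≤ m := Nat.one_le_iff_ne_zero.mpr fun h => h0 (by simp [h])
    exact (forall_isRegularAt_neg_nat_iff hω).mpr (fun n hn => bernoulliIdentity hn) m hm1
  push Not at hm
  have h1 : ∀ n : ℕ, (1 - n : ℂ) / 2 ≠ z := by
    intro n h
    -- Cross-term poles of even index 2c lie at 1/2 - c, those of odd index 2c+1 at -c; both kinds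
    -- are already excluded.
    rcases Nat.even_or_odd' n with ⟨c, rfl | rfl⟩
    · exact hk c (by rw [← h]; push_cast; ring)
    · exact hm c (by rw [← h]; push_cast; ring)
  have h2 : ∀ n : ℕ, (-n : ℂ) ≠ z := fun n h => hm n h.symm
  have h := gammaWitten_hasPolarPart hre 0 0 (fun n _ => h1 n) (fun n _ => h2 n)
  rw [if_neg h23.symm, if_neg (h1 0), if_neg (h2 0), add_zero, add_zero] at h
  exact (h.congr (Gamma_mul_eventuallyEq_gammaWitten hω hre)).isRegularAt_iff.mpr rfl

end Poles

end WittenZeta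

open WittenZeta in
theorem mainTheorem7 :
    (∃ ω : ℂ → ℂ, IsWittenZeta ω) ∧
    ∀ ω : ℂ → ℂ, IsWittenZeta ω →
      HasSimplePoleWithResidue (fun s => Complex.Gamma s * ω s) (2 / 3)
        (Complex.Gamma (1 / 3) ^ 2 / 3) ∧
      HasSimplePoleWithResidue (fun s => Complex.Gamma s * ω s) 0 (1 / 3) ∧
      (∀ k : ℕ, HasSimplePoleWithResidue (fun s => Complex.Gamma s * ω s) (1 / 2 - (k : ℂ))
        ((Real.sqrt Real.pi : ℂ) * riemannZeta ((1 - 6 * (k : ℂ)) / 2) /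
          (4 ^ k * (Nat.factorial k : ℂ)))) ∧
      (∀ z : ℂ, z ≠ 2 / 3 → z ≠ 0 → (∀ k : ℕ, z ≠ 1 / 2 - (k : ℂ)) →
        IsRegularAt (fun s => Complex.Gamma s * ω s) z) ∧
      (∀ m : ℕ, 1 ≤ m → IsRegularAt (fun s => Complex.Gamma s * ω s) (-(m : ℂ))) ∧
      (∀ n : ℕ, 1 ≤ n → BernoulliIdentity n) ∧
      ((∀ m : ℕ, 1 ≤ m → IsRegularAt (fun s => Complex.Gamma s * ω s) (-(m : ℂ))) ↔
        ∀ n : ℕ, 1 ≤ n → BernoulliIdentity n) := by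
  have hB : ∀ n : ℕ, 1 ≤ n → BernoulliIdentity n := fun n hn => bernoulliIdentity hn
  refine ⟨⟨wittenZeta, isWittenZeta_wittenZeta⟩, fun ω hω => ?_⟩
  have hiff := forall_isRegularAt_neg_nat_iff hω
  exact ⟨pole_two_thirds hω, pole_zero hω, pole_half_sub hω,
    fun z h23 h0 hk => isRegularAt_of_ne hω h23 h0 hk, hiff.mpr hB, hB, hiff⟩
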